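/- **Theorem 2.6.** Let $\Omega=(l_1,l_2)\times(l_3,l_4)$ with $l_4-l_3=N_0(l_2-l_1)$, $N_0\in\{1,2,\dots\}$, let $\psi$ be smooth and let $\Gamma_I=\{p\in\Omega:\psi(p)=0\}$ be the interface, where the corner $(l_1,l_4)$ is not in $\overline{\Gamma_I}$. Put $D=\overline\Omega\setminus\overline{\Gamma_I}$. For $N_1\in\{1,2,\dots\}$ let $N_2=N_0N_1$, $h=(l_2-l_1)/N_1$, $x_i=l_1+ih$, $y_j=l_3+jh$, so that $(x_0,y_{N_2})=(l_1,l_4)$. Consider $$-\nabla\cdot(a\nabla u)=f \text{ in } \Omega\setminus\Gamma_I,\qquad -u_x+\alpha(y)u=g_1 \text{ on } \Gamma_1=\{l_1\}\times(l_3,l_4),\qquad u_y+\beta(x)u=g_4 \text{ on } \Gamma_4=(l_1,l_2)\times\{l_4\},$$ the boundary conditions being imposed at the points of $\Gamma_1\cap D$ and of $\Gamma_4\cap D$, with $a>0$ on $D$ (the jumps across $\Gamma_I$ and the boundary values on the other two sides are arbitrary). A *4-point scheme* at $(x_0,y_{N_2})$ is a relation $$\sum_{k\in\{0,1\}}\ \sum_{\ell\in\{-1,0\}}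 C_{k,\ell}(h)\,u_{k,N_2+\ell}=\sum_{m+n\le M-1} f^{(m,n)}C_{f,m,n}(h)+\sum_{n=0}^{M} g_1^{(n)}C_{g_1,n}(h)+\sum_{n=0}^{M} g_4^{(n)}C_{g_4,n}(h)$$ with some integer $M\ge0$ and coefficients that are functions of $h$ (not depending on $u,f,g_1,g_4$), where $f^{(m,n)}=\partial_x^m\partial_y^n f(l_1,l_4)$, $g_1^{(n)}=g_1^{(n)}(l_4)$, $g_4^{(n)}=g_4^{(n)}(l_1)$. It is *non-trivial* if the $C_{k,\ell}(h)$ do not all tend to $0$ as $h\to0$. It has *order $p$* for $a,\alpha,\beta$ if for every sufficiently smooth exact solution $u$ (with data $f,g_1,g_4$) the relation with $u_{i,j}=u(x_i,y_j)$ holds up to an error $O(h^{p+1})$ as $h\to0$, $h=(l_2-l_1)/N_1$. Then: 1. Let $a\in C^6(D)$, $\alpha\in C^5([l_3,l_4])$, $\beta\in C^5([l_1,l_2])$. There is a 4-point scheme with $M=5$ which has order six, tested on all solutions $u\in C^7(D)$ with $f\in C^5(D)$, $g_1\in C^5([l_3,l_4])$, $g_4\in C^5([l_1,l_2])$. All its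 coefficients are polynomials in $h$, the $C_{k,\ell}$ have degree at most $6$ and $C_{k,\ell}(0)\ne0$ for all four $(k,\ell)$, and the coefficients are determined by $\partial_x^m\partial_y^n a(l_1,l_4)$, $m+n\le5$, and by $\alpha^{(n)}(l_4)$, $\beta^{(n)}(l_1)$, $n\le5$. 2. For 2 and 3, order is tested on solutions $u\in C^\infty(D)$ with $C^\infty$ data $f$ on $D$, $g_1$ on $[l_3,l_4]$, $g_4$ on $[l_1,l_2]$. Six is the maximum order for smooth coefficients with $\alpha(y_{N_2})\ne\beta(x_0)$: for all real $\alpha_0\ne\beta_0$, the largest integer $p$ such that for all $C^\infty$ functions $a>0$ on $D$, $\alpha$ on $[l_3,l_4]$, $\beta$ on $[l_1,l_2]$ with $\alpha(l_4)=\alpha_0$, $\beta(l_1)=\beta_0$ there is a non-trivial 4-point scheme (with any $M$) of order $p$ is $p=6$. 3. In particular, if $a>0$ is $C^\infty$ on $D$ and constant near the corner, and $\alpha$, $\beta$ are constant functions with $\alpha\ne\beta$, then no non-trivial 4-point scheme (with any $M$) has order greater than six for $a,\alpha,\beta$. -/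

import Mathlib

open Set Filter Topology Asymptotics
open scoped ContDiff

noncomputable section

namespace CornerFD

/-- The rectangle `Ω = (l₁, l₂) × (l₃, l₄)` with `l₄ - l₃ = N₀ (l₂ - l₁)`, together with the level
function `ψ` of the interface `Γ_I = {ψ = 0} ∩ Ω`.  The interface keeps away from the corner
`(l₁, l₄)`, so that all sufficiently small stencils at that corner lie on one side of it. -/
structure InterfaceDomain where
  l₁ : ℝ
  l₂ : ℝ
  l₃ : ℝ
  l₄ : ℝ
  N₀ : ℕ
  ψ : ℝ × ℝ → ℝ
  l₁_lt_l₂ : l₁ < l₂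
  N₀_pos : 0 < N₀
  sides : l₄ - l₃ = N₀ * (l₂ - l₁)
  smooth_ψ : ContDiff ℝ ∞ ψ
  corner_notMem : (l₁, l₄) ∉ closure {p : ℝ × ℝ | p ∈ Ioo l₁ l₂ ×ˢ Ioo l₃ l₄ ∧ ψ p = 0}

namespace InterfaceDomain

variable (G : InterfaceDomain)

/-- The open rectangle. -/
def Ω : Set (ℝ × ℝ) := Ioo G.l₁ G.l₂ ×ˢ Ioo G.l₃ G.l₄

/-- The interface curve. -/
def ΓI : Set (ℝ × ℝ) := {p | p ∈ G.Ω ∧ G.ψ p = 0}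

/-- The left side `{l₁} × (l₃, l₄)`. -/
def Γ₁ : Set (ℝ × ℝ) := {G.l₁} ×ˢ Ioo G.l₃ G.l₄

/-- The top side `(l₁, l₂) × {l₄}`. -/
def Γ₄ : Set (ℝ × ℝ) := Ioo G.l₁ G.l₂ ×ˢ {G.l₄}

/-- The closed rectangle without the closed interface: the set on which the data and the solution
are smooth, up to the boundary of the rectangle.  It is relatively open in the closed rectangle. -/
def D : Set (ℝ × ℝ) := closure G.Ω \ closure G.ΓI

/-- The corner where the left and the top side meet. -/
def corner : ℝ × ℝ := (G.l₁, G.l₄)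

/-- First partial derivative in `x` on `G.D`: the ordinary one at interior points, one-sided (within
the closed rectangle) at boundary points. -/
def pdx (w : ℝ × ℝ → ℝ) : ℝ × ℝ → ℝ := fun p => fderivWithin ℝ w G.D p (1, 0)

/-- First partial derivative in `y` on `G.D`. -/
def pdy (w : ℝ × ℝ → ℝ) : ℝ × ℝ → ℝ := fun p => fderivWithin ℝ w G.D p (0, 1)

/-- The partial derivative `w^{(m,n)} = ∂^{m+n} w / ∂x^m ∂y^n` at the corner. -/
def cornerDeriv (w : ℝ × ℝ → ℝ) (m n : ℕ) : ℝ := (G.pdx^[m] (G.pdy^[n] w)) G.corner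

/-- The `n`-th derivative at `l₄` of a function of `y` on the left side. -/
def leftDeriv (g : ℝ → ℝ) (n : ℕ) : ℝ := iteratedDerivWithin n g (Icc G.l₃ G.l₄) G.l₄

/-- The `n`-th derivative at `l₁` of a function of `x` on the top side. -/
def topDeriv (g : ℝ → ℝ) (n : ℕ) : ℝ := iteratedDerivWithin n g (Icc G.l₁ G.l₂) G.l₁

/-- The grid size `h = (l₂ - l₁) / N₁`. -/
def gridSize (N₁ : ℕ) : ℝ := (G.l₂ - G.l₁) / N₁

/-- The grid point `(x_k, y_{N₂ - j})`, where `x_i = l₁ + i h`, `y_i = l₃ + i h`, `N₂ = N₀ N₁`. -/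
def gridPoint (N₁ : ℕ) (k j : Fin 2) : ℝ × ℝ :=
  (G.l₁ + ((k : ℕ) : ℝ) * G.gridSize N₁,
   G.l₃ + ((G.N₀ * N₁ : ℝ) - ((j : ℕ) : ℝ)) * G.gridSize N₁)

end InterfaceDomain

/-- The coefficients of the problem: `a(x, y)` of the elliptic operator, `α(y)` of the Robin
condition on the left side and `β(x)` of the Robin condition on the top side. -/
structure Coeffs where
  a : ℝ × ℝ → ℝ
  α : ℝ → ℝ
  β : ℝ → ℝ

/-- Regularity of the coefficients at level `s`: `a` is positive and of class `C^{s+1}` off the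
interface and up to the boundary, `α` and `β` are of class `C^s`. -/
structure Coeffs.IsRegular (c : Coeffs) (G : InterfaceDomain) (s : ℕ∞) : Prop where
  a_pos : ∀ p ∈ G.D, 0 < c.a p
  a_smooth : ContDiffOn ℝ ((s + 1 : ℕ∞) : WithTop ℕ∞) c.a G.D
  α_smooth : ContDiffOn ℝ (s : WithTop ℕ∞) c.α (Icc G.l₃ G.l₄)
  β_smooth : ContDiffOn ℝ (s : WithTop ℕ∞) c.β (Icc G.l₁ G.l₂)

/-- `u` is an exact solution, of class `C^{s+2}` off the interface and up to the boundary, of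
`-∇·(a∇u) = f` in `Ω \ Γ_I` with `∂u/∂n + α u = g₁` on the left side and `∂u/∂n + β u = g₄` on the
top side (`n` is the outward normal), the data `f`, `g₁`, `g₄` being of class `C^s`.

The jumps of `u` and of its flux across the interface and the boundary values on the two other
sides are arbitrary data of the interface problem.  Every `u` as here has such data, none of which
enters a scheme at the corner, so they are not named. -/
structure IsSolution (G : InterfaceDomain) (c : Coeffs) (s : ℕ∞)
    (u f : ℝ × ℝ → ℝ) (g₁ g₄ : ℝ → ℝ) : Prop where
  u_smooth : ContDiffOn ℝ ((s + 2 : ℕ∞) : WithTop ℕ∞) u G.D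
  f_smooth : ContDiffOn ℝ (s : WithTop ℕ∞) f G.D
  g₁_smooth : ContDiffOn ℝ (s : WithTop ℕ∞) g₁ (Icc G.l₃ G.l₄)
  g₄_smooth : ContDiffOn ℝ (s : WithTop ℕ∞) g₄ (Icc G.l₁ G.l₂)
  pde : ∀ p ∈ G.Ω \ G.ΓI,
    -(G.pdx (fun q => c.a q * G.pdx u q) p + G.pdy (fun q => c.a q * G.pdy u q) p) = f p
  robin_left : ∀ p ∈ G.Γ₁ ∩ G.D, -G.pdx u p + c.α p.2 * u p = g₁ p.2
  robin_top : ∀ p ∈ G.Γ₄ ∩ G.D, G.pdy u p + c.β p.1 * u p = g₄ p.1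

/-- A 4-point scheme at the corner.  `C k j` is the coefficient, as a function of the grid size `h`,
of the unknown at `(x_k, y_{N₂ - j})`; the right-hand side is a combination of the derivatives
`f^{(m,n)}` with `m + n ≤ M - 1` and of the derivatives of `g₁` and `g₄` of orders `0, …, M`
at the corner, whose coefficients are functions of `h` too. -/
structure CornerScheme where
  M : ℕ
  C : Fin 2 → Fin 2 → ℝ → ℝ
  Cf : ℕ → ℕ → ℝ → ℝ
  Cg₁ : ℕ → ℝ → ℝ
  Cg₄ : ℕ → ℝ → ℝ

namespace CornerScheme

variable (S : CornerScheme)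

/-- The left-hand side of the scheme evaluated at `u`, on the grid with parameter `N₁`. -/
def lhs (G : InterfaceDomain) (u : ℝ × ℝ → ℝ) (N₁ : ℕ) : ℝ :=
  ∑ k : Fin 2, ∑ j : Fin 2, S.C k j (G.gridSize N₁) * u (G.gridPoint N₁ k j)

/-- The right-hand side of the scheme, on the grid with parameter `N₁`. -/
def rhs (G : InterfaceDomain) (f : ℝ × ℝ → ℝ) (g₁ g₄ : ℝ → ℝ) (N₁ : ℕ) : ℝ :=
  (∑ d ∈ Finset.range S.M, ∑ q ∈ Finset.HasAntidiagonal.antidiagonal d,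
      G.cornerDeriv f q.1 q.2 * S.Cf q.1 q.2 (G.gridSize N₁))
  + ∑ n ∈ Finset.range (S.M + 1), G.leftDeriv g₁ n * S.Cg₁ n (G.gridSize N₁)
  + ∑ n ∈ Finset.range (S.M + 1), G.topDeriv g₄ n * S.Cg₄ n (G.gridSize N₁)

/-- The scheme has order of accuracy `p` for the two Robin conditions at the corner, tested on the
solutions of regularity level `s`: for every exact solution the scheme holds up to `O(h^{p+1})` as
`h → 0`.  (The scheme is `h` times a discretization of first-order boundary conditions, hence the
exponent `p + 1`.) -/
def HasOrder (G : InterfaceDomain) (c : Coeffs) (s : ℕ∞) (p : ℕ) : Prop :=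
  ∀ (u f : ℝ × ℝ → ℝ) (g₁ g₄ : ℝ → ℝ), IsSolution G c s u f g₁ g₄ →
    (fun N₁ : ℕ => S.lhs G u N₁ - S.rhs G f g₁ g₄ N₁)
      =O[atTop] (fun N₁ : ℕ => G.gridSize N₁ ^ (p + 1))

/-- The stencil is non-trivial: its coefficients do not all tend to zero with the grid size. -/
def Nontrivial (G : InterfaceDomain) : Prop :=
  ¬ ∀ k j, Tendsto (fun N₁ : ℕ => S.C k j (G.gridSize N₁)) atTop (𝓝 0)

/-- The stencil coefficients are polynomials in `h` of degree at most `d`, and those of the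
right-hand side are polynomials in `h`. -/
structure IsPolynomial (d : ℕ) : Prop where
  C_poly : ∀ k j, ∃ P : Polynomial ℝ, P.natDegree ≤ d ∧ ∀ h, S.C k j h = P.eval h
  Cf_poly : ∀ m n, ∃ P : Polynomial ℝ, ∀ h, S.Cf m n h = P.eval h
  Cg₁_poly : ∀ n, ∃ P : Polynomial ℝ, ∀ h, S.Cg₁ n h = P.eval h
  Cg₄_poly : ∀ n, ∃ P : Polynomial ℝ, ∀ h, S.Cg₄ n h = P.eval h

end CornerScheme

/-- Values of derivatives at the corner of the three coefficients of the problem. -/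
structure CornerJet where
  a : ℕ → ℕ → ℝ
  α : ℕ → ℝ
  β : ℕ → ℝ

/-- The jet of order `M` of the coefficients at the corner: the derivatives `a^{(m,n)}` with
`m + n ≤ M`, and `α^{(n)}`, `β^{(n)}` with `n ≤ M` (entries of higher order are set to zero). -/
def Coeffs.jet (c : Coeffs) (G : InterfaceDomain) (M : ℕ) : CornerJet where
  a := fun m n => if m + n ≤ M then G.cornerDeriv c.a m n else 0
  α := fun n => if n ≤ M then G.leftDeriv c.α n else 0
  β := fun n => if n ≤ M then G.topDeriv c.β n else 0

end CornerFD

end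

/-!
At the corner the equation and the two Robin conditions express every derivative of `u` of order
at most six, up to derivatives of `f`, `g₁`, `g₄`, through the pure derivatives `∂ₓ²ⁱ u`, `i ≤ 3`:
modulo lower order the relations are those of the Neumann Laplacian, whose solutions are the
multiples of `Re (x + i y) ^ (2 i)`. A sixth-order scheme is a stencil which annihilates, modulo
`h ^ 7`, the four Taylor expansions multiplying these derivatives. The expansion for `i = 3` costs
no further unknown: the values of `Re (x + i y) ^ 2` and `Re (x + i y) ^ 6` at the stencil points
are proportional.

For `a`, `α`, `β` constant near the corner, `Re (x + i y) ^ (2 n)`, `n ≤ 3`, extends to a harmonic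
polynomial with homogeneous Robin data, on which the stencil of a scheme of order `p` is
`O(h ^ (p + 1))`. If `p ≥ 7`, the corrections of relative order `h`, which make the cases `n = 1`
and `n = 3` independent exactly when `α ≠ β`, become visible and force all stencil coefficients to
zero.
-/

namespace CornerFD

/-! ### Iterated directional derivatives -/

section DirectionalDerivative

variable {E F : Type*} [NormedAddCommGroup E] [NormedSpace ℝ E]
  [NormedAddCommGroup F] [NormedSpace ℝ F]

/-- The derivative of `w` within `s` in the constant direction `v`, as a function of the base point,
so that it can be iterated.  Both `InterfaceDomain.pdx` and `InterfaceDomain.pdy` are of this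
form. -/
noncomputable def dirDerivWithin (s : Set E) (v : E) (w : E → F) : E → F :=
  fun p => fderivWithin ℝ w s p v

variable {s : Set E} {v v' : E} {w w' : E → F}

theorem contDiffOn_dirDerivWithin (hs : UniqueDiffOn ℝ s) {n m : WithTop ℕ∞}
    (hw : ContDiffOn ℝ n w s) (hmn : m + 1 ≤ n) : ContDiffOn ℝ m (dirDerivWithin s v w) s :=
  (hw.fderivWithin hs hmn).clm_apply contDiffOn_const

theorem contDiffOn_iterate_dirDerivWithin (hs : UniqueDiffOn ℝ s) {n m : WithTop ℕ∞} (k : ℕ)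
    (hw : ContDiffOn ℝ n w s) (hmn : m + k ≤ n) :
    ContDiffOn ℝ m ((dirDerivWithin s v)^[k] w) s := by
  induction k generalizing n w with
  | zero => exact hw.of_le (by simpa using hmn)
  | succ k ih =>
    rw [Function.iterate_succ_apply]
    refine ih (contDiffOn_dirDerivWithin hs hw (m := m + k) ?_) le_rfl
    simpa [add_assoc] using hmn

theorem dirDerivWithin_eq_of_hasFDerivAt (hs : UniqueDiffOn ℝ s) {p : E} (hp : p ∈ s)
    {L : E →L[ℝ] F} (h : HasFDerivAt w L p) : dirDerivWithin s v w p = L v := by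
  rw [dirDerivWithin, h.hasFDerivWithinAt.fderivWithin (hs p hp)]

theorem eqOn_dirDerivWithin (h : EqOn w w' s) :
    EqOn (dirDerivWithin s v w) (dirDerivWithin s v w') s := fun p hp => by
  rw [dirDerivWithin, dirDerivWithin, fderivWithin_congr h (h hp)]

theorem eqOn_iterate_dirDerivWithin (k : ℕ) (h : EqOn w w' s) :
    EqOn ((dirDerivWithin s v)^[k] w) ((dirDerivWithin s v)^[k] w') s := by
  induction k with
  | zero => exact h
  | succ k ih => simpa only [Function.iterate_succ_apply'] using eqOn_dirDerivWithin ih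

theorem eventuallyEq_iterate_dirDerivWithin {p : E} (n : ℕ) (h : w =ᶠ[𝓝[s] p] w') :
    (dirDerivWithin s v)^[n] w =ᶠ[𝓝[s] p] (dirDerivWithin s v)^[n] w' := by
  induction n with
  | zero => exact h
  | succ n ih =>
    simp only [Function.iterate_succ_apply']
    filter_upwards [ih.fderivWithin (𝕜 := ℝ)] with q hq
    simp only [dirDerivWithin, hq]

theorem iterate_dirDerivWithin_zero (n : ℕ) :
    (dirDerivWithin s v)^[n] (fun _ => (0 : F)) = fun _ => 0 :=
  Function.iterate_fixed (by funext p; simp [dirDerivWithin]) n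

theorem dirDerivWithin_sum (hs : UniqueDiffOn ℝ s) {ι : Type*} (I : Finset ι) (c : ι → ℝ)
    (W : ι → E → F) (hW : ∀ i ∈ I, ContDiffOn ℝ 1 (W i) s) :
    EqOn (dirDerivWithin s v (fun p => ∑ i ∈ I, c i • W i p))
      (fun p => ∑ i ∈ I, c i • dirDerivWithin s v (W i) p) s := by
  intro p hp
  have hd : ∀ i ∈ I, DifferentiableWithinAt ℝ (W i) s p := fun i hi =>
    (hW i hi).differentiableOn one_ne_zero p hp
  simp only [dirDerivWithin]
  rw [fderivWithin_fun_sum (hs p hp) fun i hi => (hd i hi).fun_const_smul (c i), sum_apply]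
  refine Finset.sum_congr rfl fun i hi => ?_
  rw [fderivWithin_fun_const_smul (hs p hp) (hd i hi) (c i), FunLike.coe_smul, Pi.smul_apply]

theorem iterate_dirDerivWithin_sum (hs : UniqueDiffOn ℝ s) {ι : Type*} (I : Finset ι) (c : ι → ℝ)
    (m : ℕ) (W : ι → E → F) (hW : ∀ i ∈ I, ContDiffOn ℝ m (W i) s) :
    EqOn ((dirDerivWithin s v)^[m] (fun p => ∑ i ∈ I, c i • W i p))
      (fun p => ∑ i ∈ I, c i • (dirDerivWithin s v)^[m] (W i) p) s := by
  induction m generalizing W with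
  | zero => exact fun _ _ => rfl
  | succ m ih =>
    simp only [Function.iterate_succ_apply]
    refine (eqOn_iterate_dirDerivWithin m (dirDerivWithin_sum hs I c W fun i hi =>
      (hW i hi).of_le (by norm_cast; omega))).trans ?_
    exact ih _ fun i hi => contDiffOn_dirDerivWithin hs (hW i hi) (by norm_cast)

theorem dirDerivWithin_smul (hs : UniqueDiffOn ℝ s) {b : E → ℝ} (hb : ContDiffOn ℝ 1 b s)
    (hw : ContDiffOn ℝ 1 w s) :
    EqOn (dirDerivWithin s v (fun p => b p • w p))
      (fun p => b p • dirDerivWithin s v w p + dirDerivWithin s v b p • w p) s := by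
  intro p hp
  simp only [dirDerivWithin]
  rw [fderivWithin_fun_smul (hs p hp) (hb.differentiableOn one_ne_zero p hp)
    (hw.differentiableOn one_ne_zero p hp)]
  simp

theorem iterate_dirDerivWithin_smul (hs : UniqueDiffOn ℝ s) {b : E → ℝ} (n : ℕ)
    (hb : ContDiffOn ℝ n b s) (hw : ContDiffOn ℝ n w s) :
    EqOn ((dirDerivWithin s v)^[n] (fun p => b p • w p))
      (fun p => ∑ ij ∈ Finset.HasAntidiagonal.antidiagonal n, (n.choose ij.1 : ℝ) •
        (dirDerivWithin s v)^[ij.1] b p • (dirDerivWithin s v)^[ij.2] w p) s := by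
  induction n with
  | zero => intro p _; simp
  | succ n ih =>
    have hle : (n : WithTop ℕ∞) ≤ ((n + 1 : ℕ) : WithTop ℕ∞) := by norm_cast; omega
    have hb' : ∀ i ≤ n, ContDiffOn ℝ 1 ((dirDerivWithin s v)^[i] b) s := fun i hi =>
      contDiffOn_iterate_dirDerivWithin hs i hb (by norm_cast; omega)
    have hw' : ∀ i ≤ n, ContDiffOn ℝ 1 ((dirDerivWithin s v)^[i] w) s := fun i hi =>
      contDiffOn_iterate_dirDerivWithin hs i hw (by norm_cast; omega)
    rw [Function.iterate_succ_apply']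
    refine (eqOn_dirDerivWithin (ih (hb.of_le hle) (hw.of_le hle))).trans ?_
    have hsum := dirDerivWithin_sum (v := v) hs (Finset.HasAntidiagonal.antidiagonal n)
      (fun ij => (n.choose ij.1 : ℝ))
      (fun ij p => (dirDerivWithin s v)^[ij.1] b p • (dirDerivWithin s v)^[ij.2] w p)
      fun ij hij => (hb' _ (Finset.HasAntidiagonal.antidiagonal.fst_le hij)).smul
        (hw' _ (Finset.HasAntidiagonal.antidiagonal.snd_le hij))
    refine hsum.trans fun p hp => ?_
    simp only [Nat.cast_smul_eq_nsmul]
    rw [Finset.sum_antidiagonal_choose_succ_nsmul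
      (fun i j => (dirDerivWithin s v)^[i] b p • (dirDerivWithin s v)^[j] w p),
      ← Finset.sum_add_distrib]
    refine Finset.sum_congr rfl fun ij hij => ?_
    rw [dirDerivWithin_smul hs (hb' _ (Finset.HasAntidiagonal.antidiagonal.fst_le hij))
      (hw' _ (Finset.HasAntidiagonal.antidiagonal.snd_le hij)) hp, smul_add,
      Nat.choose_symm_of_eq_add (Finset.HasAntidiagonal.mem_antidiagonal.1 hij).symm]
    simp only [Function.iterate_succ_apply']

theorem dirDerivWithin_comm (hs : UniqueDiffOn ℝ s) (hcl : s ⊆ closure (interior s))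
    (hw : ContDiffOn ℝ 2 w s) :
    EqOn (dirDerivWithin s v (dirDerivWithin s v' w))
      (dirDerivWithin s v' (dirDerivWithin s v w)) s := by
  intro p hp
  have hd : DifferentiableWithinAt ℝ (fderivWithin ℝ w s) s p :=
    (hw.fderivWithin (m := 1) hs (by norm_num)).differentiableOn one_ne_zero p hp
  have hsecond : ∀ u u' : E, dirDerivWithin s u (dirDerivWithin s u' w) p
      = fderivWithin ℝ (fderivWithin ℝ w s) s p u u' := fun u u' => by
    change fderivWithin ℝ (fun q => fderivWithin ℝ w s q u') s p u = _
    rw [fderivWithin_clm_apply (hs p hp) hd (differentiableWithinAt_const u')]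
    simp
  rw [hsecond, hsecond]
  exact (hw p hp).isSymmSndFDerivWithinAt (by simp) hs (hcl hp) hp v v'

theorem iterate_dirDerivWithin_comm (hs : UniqueDiffOn ℝ s) (hcl : s ⊆ closure (interior s))
    (n : ℕ) (hw : ContDiffOn ℝ (n + 1 : ℕ) w s) :
    EqOn ((dirDerivWithin s v)^[n] (dirDerivWithin s v' w))
      (dirDerivWithin s v' ((dirDerivWithin s v)^[n] w)) s := by
  induction n generalizing w with
  | zero => exact fun _ _ => rfl
  | succ n ih =>
    simp only [Function.iterate_succ_apply]
    refine (eqOn_iterate_dirDerivWithin n (dirDerivWithin_comm hs hcl (hw.of_le ?_))).trans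
      (ih (contDiffOn_dirDerivWithin hs hw (by norm_cast)))
    norm_cast; omega

theorem dirDerivWithin_add_smul (v v' : E) (c d : ℝ) (p : E) :
    dirDerivWithin s (c • v + d • v') w p
      = c • dirDerivWithin s v w p + d • dirDerivWithin s v' w p := by
  simp only [dirDerivWithin, map_add, map_smul]

theorem iterate_dirDerivWithin_add_smul (hs : UniqueDiffOn ℝ s) (hcl : s ⊆ closure (interior s))
    (c d : ℝ) (n : ℕ) (hw : ContDiffOn ℝ n w s) :
    EqOn ((dirDerivWithin s (c • v + d • v'))^[n] w)
      (fun p => ∑ ij ∈ Finset.HasAntidiagonal.antidiagonal n,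
        ((n.choose ij.1 : ℝ) * (c ^ ij.1 * d ^ ij.2)) •
          (dirDerivWithin s v)^[ij.1] ((dirDerivWithin s v')^[ij.2] w) p) s := by
  induction n with
  | zero => intro p _; simp
  | succ n ih =>
    have hmixed : ∀ ij ∈ Finset.HasAntidiagonal.antidiagonal n,
        ContDiffOn ℝ 1 ((dirDerivWithin s v)^[ij.1] ((dirDerivWithin s v')^[ij.2] w)) s :=
      fun ij hij => by
        rw [Finset.HasAntidiagonal.mem_antidiagonal] at hij
        refine contDiffOn_iterate_dirDerivWithin hs ij.1 (n := (1 + ij.1 : ℕ)) ?_ (by norm_cast)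
        exact contDiffOn_iterate_dirDerivWithin hs ij.2 hw (by norm_cast; omega)
    rw [Function.iterate_succ_apply']
    refine (eqOn_dirDerivWithin (ih (hw.of_le (by norm_cast; omega)))).trans <|
      (dirDerivWithin_sum hs _ _ _ hmixed).trans fun p hp => ?_
    simp only [mul_smul, Nat.cast_smul_eq_nsmul]
    rw [Finset.sum_antidiagonal_choose_succ_nsmul (fun i j => c ^ i • d ^ j •
      (dirDerivWithin s v)^[i] ((dirDerivWithin s v')^[j] w) p), ← Finset.sum_add_distrib]
    refine Finset.sum_congr rfl fun ij hij => ?_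
    have hcomm : dirDerivWithin s v' ((dirDerivWithin s v)^[ij.1] ((dirDerivWithin s v')^[ij.2] w))
        p = (dirDerivWithin s v)^[ij.1] ((dirDerivWithin s v')^[ij.2 + 1] w) p := by
      rw [Finset.HasAntidiagonal.mem_antidiagonal] at hij
      rw [Function.iterate_succ_apply']
      exact (iterate_dirDerivWithin_comm hs hcl ij.1 (contDiffOn_iterate_dirDerivWithin hs ij.2 hw
        (by norm_cast; omega)) hp).symm
    rw [dirDerivWithin_add_smul, hcomm,
      Nat.choose_symm_of_eq_add (Finset.HasAntidiagonal.mem_antidiagonal.1 hij).symm,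
      ← Function.iterate_succ_apply' (dirDerivWithin s v)]
    module

theorem iteratedDerivWithin_comp_line {I : Set ℝ} (hI : UniqueDiffOn ℝ I) (hs : UniqueDiffOn ℝ s)
    (q : E) (hIs : ∀ t ∈ I, q + t • v ∈ s) (n : ℕ) (hw : ContDiffOn ℝ n w s) {t : ℝ} (ht : t ∈ I) :
    iteratedDerivWithin n (fun t => w (q + t • v)) I t
      = (dirDerivWithin s v)^[n] w (q + t • v) := by
  induction n generalizing w with
  | zero => simp
  | succ n ih =>
    rw [iteratedDerivWithin_succ', Function.iterate_succ_apply,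
      ← ih (contDiffOn_dirDerivWithin hs hw (by norm_cast))]
    refine iteratedDerivWithin_congr (fun r hr => ?_) ht
    have hw' := (hw.differentiableOn (by simp) _ (hIs r hr)).hasFDerivWithinAt
    have hline : HasDerivWithinAt (fun t : ℝ => q + t • v) v I r := by
      simpa using (((hasDerivAt_id r).smul_const v).const_add q).hasDerivWithinAt
    exact (hw'.comp_hasDerivWithinAt r hline hIs).derivWithin (hI r hr)

variable {q : E}

theorem iteratedDerivWithin_eq_of_eqOn_line {J : Set ℝ} {a b t₀ : ℝ} (hab : a < b)
    (ht₀ : t₀ ∈ Icc a b) (hJ : J =ᶠ[𝓝 t₀] Icc a b) (hs : UniqueDiffOn ℝ s)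
    (hline : ∀ t ∈ Icc a b, q + t • v ∈ s) (n : ℕ) (hw : ContDiffOn ℝ n w s) {g : ℝ → F}
    (hg : ContinuousOn g (Icc a b)) (h : ∀ t ∈ Ioo a b, g t = w (q + t • v)) :
    iteratedDerivWithin n g J t₀ = (dirDerivWithin s v)^[n] w (q + t₀ • v) := by
  have hEq : EqOn g (fun t => w (q + t • v)) (Icc a b) :=
    EqOn.of_subset_closure h hg (hw.continuousOn.comp (by fun_prop) hline) Ioo_subset_Icc_self
      (closure_Ioo hab.ne).ge
  rw [iteratedDerivWithin, iteratedFDerivWithin_congr_set hJ, ← iteratedDerivWithin,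
    iteratedDerivWithin_congr hEq ht₀,
    iteratedDerivWithin_comp_line (uniqueDiffOn_Icc hab) hs q hline n hw ht₀]

theorem exists_taylor_line_bound (hs : UniqueDiffOn ℝ s) {δ : ℝ} (hδ : 0 < δ)
    (hline : ∀ t ∈ Icc 0 δ, q + t • v ∈ s) (d : ℕ) (hw : ContDiffOn ℝ (d + 1 : ℕ) w s) :
    ∃ C, ∀ t ∈ Icc 0 δ, ‖w (q + t • v) - ∑ i ∈ Finset.range (d + 1),
      (t ^ i / i.factorial) • (dirDerivWithin s v)^[i] w q‖ ≤ C * t ^ (d + 1) := by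
  have hrestrict : ContDiffOn ℝ (d + 1) (fun t : ℝ => w (q + t • v)) (Icc 0 δ) :=
    ContDiffOn.comp (t := s) (by exact_mod_cast hw)
      (contDiff_const.add (contDiff_id.smul contDiff_const)).contDiffOn hline
  obtain ⟨C, hC⟩ := exists_taylor_mean_remainder_bound hδ.le hrestrict
  refine ⟨C, fun t ht => ?_⟩
  have hpoly : taylorWithinEval (fun t : ℝ => w (q + t • v)) d (Icc 0 δ) 0 t
      = ∑ i ∈ Finset.range (d + 1), (t ^ i / i.factorial) • (dirDerivWithin s v)^[i] w q := by
    rw [taylor_within_apply]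
    refine Finset.sum_congr rfl fun i hi => ?_
    rw [iteratedDerivWithin_comp_line (uniqueDiffOn_Icc hδ) hs q hline i
      (hw.of_le (by norm_cast; exact (Finset.mem_range.1 hi).le)) ⟨le_rfl, hδ.le⟩,
      zero_smul, add_zero, sub_zero, inv_mul_eq_div]
  simpa only [hpoly, sub_zero] using hC t ht

end DirectionalDerivative

/-! ### Partial derivatives and Taylor expansion at the corner -/

section Jets

variable {Q R : Type*} [AddCommGroup Q] [Module ℝ Q] [AddCommGroup R] [Module ℝ R]

/-- The derivatives at a point of the product of two functions of one variable with derivatives `b`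
and `U`. -/
noncomputable def jetMul₁ (b : ℕ → ℝ) (U : ℕ → Q) (n : ℕ) : Q :=
  ∑ q ∈ Finset.HasAntidiagonal.antidiagonal n, (n.choose q.1 * b q.1 : ℝ) • U q.2

/-- The partial derivatives at a point of the product of two functions of two variables with partial
derivatives `a` and `U`. -/
noncomputable def jetMul (a : ℕ → ℕ → ℝ) (U : ℕ → ℕ → Q) (m n : ℕ) : Q :=
  ∑ q ∈ Finset.HasAntidiagonal.antidiagonal n, ∑ p ∈ Finset.HasAntidiagonal.antidiagonal m,
    (n.choose q.1 * m.choose p.1 * a p.1 q.1 : ℝ) • U p.2 q.2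

/-- The coefficient of `h ^ d` in the Taylor expansion, at the stencil point `(k h, -j h)`, of a
function with partial derivatives `U` at the origin. -/
noncomputable def stencilTaylor (U : ℕ → ℕ → Q) (k j : Fin 2) (d : ℕ) : Q :=
  ∑ p ∈ Finset.HasAntidiagonal.antidiagonal d,
    (((k : ℕ) : ℝ) ^ p.1 * (-((j : ℕ) : ℝ)) ^ p.2 / (p.1.factorial * p.2.factorial)) • U p.1 p.2

theorem map_jetMul₁ (φ : Q →ₗ[ℝ] R) (b : ℕ → ℝ) (U : ℕ → Q) (n : ℕ) :
    φ (jetMul₁ b U n) = jetMul₁ b (fun i => φ (U i)) n := by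
  simp only [jetMul₁, map_sum, map_smul]

theorem map_jetMul (φ : Q →ₗ[ℝ] R) (a : ℕ → ℕ → ℝ) (U : ℕ → ℕ → Q) (m n : ℕ) :
    φ (jetMul a U m n) = jetMul a (fun i j => φ (U i j)) m n := by
  simp only [jetMul, map_sum, map_smul]

theorem map_stencilTaylor (φ : Q →ₗ[ℝ] R) (U : ℕ → ℕ → Q) (k j : Fin 2) (d : ℕ) :
    φ (stencilTaylor U k j d) = stencilTaylor (fun m n => φ (U m n)) k j d := by
  simp only [stencilTaylor, map_sum, map_smul]

end Jets

namespace InterfaceDomain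

variable (G : InterfaceDomain)

theorem l₃_lt_l₄ : G.l₃ < G.l₄ := by
  have hpos : 0 < G.l₄ - G.l₃ :=
    G.sides ▸ mul_pos (Nat.cast_pos.2 G.N₀_pos) (sub_pos.2 G.l₁_lt_l₂)
  exact sub_pos.1 hpos

theorem closure_Ω : closure G.Ω = Icc G.l₁ G.l₂ ×ˢ Icc G.l₃ G.l₄ := by
  rw [Ω, closure_prod_eq, closure_Ioo G.l₁_lt_l₂.ne, closure_Ioo G.l₃_lt_l₄.ne]

theorem D_subset_prod_Icc : G.D ⊆ Icc G.l₁ G.l₂ ×ˢ Icc G.l₃ G.l₄ :=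
  G.closure_Ω ▸ sdiff_subset

theorem corner_mem_D : G.corner ∈ G.D := by
  refine ⟨?_, G.corner_notMem⟩
  rw [closure_Ω]
  exact ⟨⟨le_rfl, G.l₁_lt_l₂.le⟩, ⟨G.l₃_lt_l₄.le, le_rfl⟩⟩

theorem D_subset_closure_Ω_diff : G.D ⊆ closure (G.Ω \ closure G.ΓI) := fun p hp => by
  rw [sdiff_eq, inter_comm]
  exact isClosed_closure.isOpen_compl.inter_closure ⟨hp.2, hp.1⟩

theorem D_subset_closure_interior : G.D ⊆ closure (interior G.D) :=
  G.D_subset_closure_Ω_diff.trans <| closure_mono <| interior_maximal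
    (sdiff_subset_sdiff_left subset_closure) ((isOpen_Ioo.prod isOpen_Ioo).sdiff isClosed_closure)

theorem uniqueDiffOn_D : UniqueDiffOn ℝ G.D := by
  have h : UniqueDiffOn ℝ (closure G.Ω) := G.closure_Ω ▸
    (uniqueDiffOn_Icc G.l₁_lt_l₂).prod (uniqueDiffOn_Icc G.l₃_lt_l₄)
  exact h.inter isClosed_closure.isOpen_compl

theorem exists_square_subset_D : ∃ δ > 0, G.l₁ + δ < G.l₂ ∧ G.l₃ < G.l₄ - δ ∧
    Icc G.l₁ (G.l₁ + δ) ×ˢ Icc (G.l₄ - δ) G.l₄ ⊆ G.D := by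
  obtain ⟨ε, hε, hball⟩ := Metric.isOpen_iff.1 isClosed_closure.isOpen_compl G.corner
    G.corner_notMem
  obtain ⟨δ, hδ, hlt⟩ :=
    exists_between (lt_min hε (lt_min (sub_pos.2 G.l₁_lt_l₂) (sub_pos.2 G.l₃_lt_l₄)))
  obtain ⟨hδε, hδ₁, hδ₃⟩ : δ < ε ∧ δ < G.l₂ - G.l₁ ∧ δ < G.l₄ - G.l₃ := by
    simpa only [lt_min_iff] using hlt
  refine ⟨δ, hδ, by linarith, by linarith, ?_⟩
  rintro ⟨x, y⟩ ⟨⟨hx₁, hx₂⟩, hy₁, hy₂⟩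
  dsimp only at hx₁ hx₂ hy₁ hy₂
  refine ⟨?_, hball ?_⟩
  · rw [closure_Ω]
    exact ⟨⟨hx₁, by linarith⟩, ⟨by linarith, hy₂⟩⟩
  · rw [Metric.mem_ball, Prod.dist_eq, max_lt_iff, Real.dist_eq, Real.dist_eq, abs_lt, abs_lt]
    simp only [corner]
    refine ⟨⟨?_, ?_⟩, ?_, ?_⟩ <;> linarith

variable {G} {w w' : ℝ × ℝ → ℝ}

theorem contDiffOn_pdx {n m : WithTop ℕ∞} (hw : ContDiffOn ℝ n w G.D) (hmn : m + 1 ≤ n) :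
    ContDiffOn ℝ m (G.pdx w) G.D :=
  contDiffOn_dirDerivWithin G.uniqueDiffOn_D hw hmn

theorem contDiffOn_pdy {n m : WithTop ℕ∞} (hw : ContDiffOn ℝ n w G.D) (hmn : m + 1 ≤ n) :
    ContDiffOn ℝ m (G.pdy w) G.D :=
  contDiffOn_dirDerivWithin G.uniqueDiffOn_D hw hmn

theorem contDiffOn_iterate_pdy (m n : ℕ) (hw : ContDiffOn ℝ (m + n : ℕ) w G.D) :
    ContDiffOn ℝ m (G.pdy^[n] w) G.D :=
  contDiffOn_iterate_dirDerivWithin G.uniqueDiffOn_D n hw (by norm_cast)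

theorem cornerDeriv_congr (h : EqOn w w' G.D) (m n : ℕ) :
    G.cornerDeriv w m n = G.cornerDeriv w' m n :=
  eqOn_iterate_dirDerivWithin m (eqOn_iterate_dirDerivWithin n h) G.corner_mem_D

theorem cornerDeriv_pdx (m n : ℕ) (hw : ContDiffOn ℝ (n + 1 : ℕ) w G.D) :
    G.cornerDeriv (G.pdx w) m n = G.cornerDeriv w (m + 1) n :=
  eqOn_iterate_dirDerivWithin m
    (iterate_dirDerivWithin_comm G.uniqueDiffOn_D G.D_subset_closure_interior n hw) G.corner_mem_D

theorem cornerDeriv_pdy (m n : ℕ) : G.cornerDeriv (G.pdy w) m n = G.cornerDeriv w m (n + 1) := rfl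

theorem cornerDeriv_sum {ι : Type*} (I : Finset ι) (c : ι → ℝ) (W : ι → ℝ × ℝ → ℝ) (m n : ℕ)
    (hW : ∀ i ∈ I, ContDiffOn ℝ (m + n : ℕ) (W i) G.D) :
    G.cornerDeriv (fun p => ∑ i ∈ I, c i * W i p) m n = ∑ i ∈ I, c i * G.cornerDeriv (W i) m n :=
  (eqOn_iterate_dirDerivWithin m (iterate_dirDerivWithin_sum G.uniqueDiffOn_D I c n W fun i hi =>
      (hW i hi).of_le (by norm_cast; omega)) G.corner_mem_D).trans
    (iterate_dirDerivWithin_sum G.uniqueDiffOn_D I c m (fun i => G.pdy^[n] (W i))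
      (fun i hi => contDiffOn_iterate_pdy m n (hW i hi)) G.corner_mem_D)

theorem cornerDeriv_mul (m n : ℕ) (hw : ContDiffOn ℝ (m + n : ℕ) w G.D)
    (hw' : ContDiffOn ℝ (m + n : ℕ) w' G.D) :
    G.cornerDeriv (fun p => w p * w' p) m n
      = jetMul (G.cornerDeriv w) (G.cornerDeriv w') m n := by
  have hpdy : ∀ {f : ℝ × ℝ → ℝ}, ContDiffOn ℝ (m + n : ℕ) f G.D → ∀ j ≤ n,
      ContDiffOn ℝ m (G.pdy^[j] f) G.D := fun hf j hj =>
    contDiffOn_iterate_pdy m j (hf.of_le (by norm_cast; omega))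
  have hLeibniz_y := iterate_dirDerivWithin_smul (v := ((0, 1) : ℝ × ℝ)) G.uniqueDiffOn_D n
    (hw.of_le (by norm_cast; omega)) (hw'.of_le (by norm_cast; omega))
  refine (eqOn_iterate_dirDerivWithin m hLeibniz_y G.corner_mem_D).trans
    ((iterate_dirDerivWithin_sum G.uniqueDiffOn_D (Finset.HasAntidiagonal.antidiagonal n)
      (fun q => (n.choose q.1 : ℝ)) m (fun q p => G.pdy^[q.1] w p • G.pdy^[q.2] w' p)
      (fun q hq => (hpdy hw _ (Finset.HasAntidiagonal.antidiagonal.fst_le hq)).smul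
        (hpdy hw' _ (Finset.HasAntidiagonal.antidiagonal.snd_le hq))) G.corner_mem_D).trans ?_)
  refine Finset.sum_congr rfl fun q hq => ?_
  rw [iterate_dirDerivWithin_smul G.uniqueDiffOn_D m
      (hpdy hw _ (Finset.HasAntidiagonal.antidiagonal.fst_le hq))
      (hpdy hw' _ (Finset.HasAntidiagonal.antidiagonal.snd_le hq)) G.corner_mem_D,
    Finset.smul_sum]
  refine Finset.sum_congr rfl fun p _ => ?_
  simp only [smul_eq_mul, cornerDeriv, mul_assoc]
  rfl

theorem leftDeriv_eq_cornerDeriv {g : ℝ → ℝ} (n : ℕ) (hw : ContDiffOn ℝ n w G.D)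
    (hg : ContinuousOn g (Icc G.l₃ G.l₄)) (h : ∀ p ∈ G.Γ₁ ∩ G.D, w p = g p.2) :
    G.leftDeriv g n = G.cornerDeriv w 0 n := by
  obtain ⟨δ, hδ, -, hδ₃, hsub⟩ := G.exists_square_subset_D
  have hlt : G.l₄ - δ < G.l₄ := sub_lt_self _ hδ
  have hline : ∀ t ∈ Icc (G.l₄ - δ) G.l₄, ((G.l₁, 0) : ℝ × ℝ) + t • (0, 1) ∈ G.D := fun t ht =>
    hsub (by simpa [hδ.le] using ht)
  have hset : Icc G.l₃ G.l₄ =ᶠ[𝓝 G.l₄] Icc (G.l₄ - δ) G.l₄ := by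
    filter_upwards [Ioi_mem_nhds hlt] with t ht
    exact propext (and_congr_left fun _ => iff_of_true (hδ₃.trans ht).le ht.le)
  have hg' : ∀ t ∈ Ioo (G.l₄ - δ) G.l₄, g t = w ((G.l₁, 0) + t • (0, 1)) := fun t ht => by
    have hΓ : ((G.l₁, 0) : ℝ × ℝ) + t • (0, 1) ∈ G.Γ₁ := by
      simpa [Γ₁] using And.intro (hδ₃.trans ht.1) ht.2
    rw [h _ ⟨hΓ, hline t (Ioo_subset_Icc_self ht)⟩]
    simp
  rw [leftDeriv, iteratedDerivWithin_eq_of_eqOn_line hlt (right_mem_Icc.2 hlt.le) hset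
    G.uniqueDiffOn_D hline n hw (hg.mono (Icc_subset_Icc_left hδ₃.le)) hg']
  simp only [smul_eq_mul, mul_one, Prod.smul_mk, mul_zero, Prod.mk_add_mk, add_zero, zero_add]
  rfl

theorem topDeriv_eq_cornerDeriv {g : ℝ → ℝ} (n : ℕ) (hw : ContDiffOn ℝ n w G.D)
    (hg : ContinuousOn g (Icc G.l₁ G.l₂)) (h : ∀ p ∈ G.Γ₄ ∩ G.D, w p = g p.1) :
    G.topDeriv g n = G.cornerDeriv w n 0 := by
  obtain ⟨δ, hδ, hδ₂, -, hsub⟩ := G.exists_square_subset_D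
  have hlt : G.l₁ < G.l₁ + δ := lt_add_of_pos_right _ hδ
  have hline : ∀ t ∈ Icc G.l₁ (G.l₁ + δ), ((0, G.l₄) : ℝ × ℝ) + t • (1, 0) ∈ G.D := fun t ht =>
    hsub (by simpa [hδ.le] using ht)
  have hset : Icc G.l₁ G.l₂ =ᶠ[𝓝 G.l₁] Icc G.l₁ (G.l₁ + δ) := by
    filter_upwards [Iio_mem_nhds hlt] with t ht
    exact propext (and_congr_right fun _ => iff_of_true (ht.trans hδ₂).le ht.le)
  have hg' : ∀ t ∈ Ioo G.l₁ (G.l₁ + δ), g t = w ((0, G.l₄) + t • (1, 0)) := fun t ht => by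
    have hΓ : ((0, G.l₄) : ℝ × ℝ) + t • (1, 0) ∈ G.Γ₄ := by
      simpa [Γ₄] using And.intro ht.1 (ht.2.trans hδ₂)
    rw [h _ ⟨hΓ, hline t (Ioo_subset_Icc_self ht)⟩]
    simp
  rw [topDeriv, iteratedDerivWithin_eq_of_eqOn_line hlt (left_mem_Icc.2 hlt.le) hset
    G.uniqueDiffOn_D hline n hw (hg.mono (Icc_subset_Icc_right hδ₂.le)) hg']
  simp only [smul_eq_mul, mul_one, Prod.smul_mk, mul_zero, Prod.mk_add_mk, add_zero, zero_add]
  rfl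

theorem gridSize_pos {N₁ : ℕ} (h : 0 < N₁) : 0 < G.gridSize N₁ :=
  div_pos (sub_pos.2 G.l₁_lt_l₂) (Nat.cast_pos.2 h)

variable (G) in
theorem tendsto_gridSize : Tendsto G.gridSize atTop (𝓝 0) :=
  tendsto_const_div_atTop_nhds_zero_nat _

theorem gridPoint_eq {N₁ : ℕ} (h : 0 < N₁) (k j : Fin 2) : G.gridPoint N₁ k j =
    G.corner + G.gridSize N₁ • (((k : ℕ) : ℝ), -((j : ℕ) : ℝ)) := by
  have hN₁ : (N₁ : ℝ) ≠ 0 := Nat.cast_ne_zero.2 h.ne'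
  have hheight : (G.N₀ * N₁ : ℝ) * G.gridSize N₁ = G.l₄ - G.l₃ := by
    rw [G.sides, gridSize]; field_simp
  ext
  · simp [gridPoint, corner, mul_comm]
  · simp only [gridPoint, corner, Prod.snd_add, Prod.smul_snd, smul_eq_mul]
    linear_combination hheight

theorem iterate_dirDerivWithin_corner (k j : Fin 2) (d : ℕ) (hw : ContDiffOn ℝ d w G.D) :
    (dirDerivWithin G.D (((k : ℕ) : ℝ), -((j : ℕ) : ℝ)))^[d] w G.corner
      = d.factorial * stencilTaylor (G.cornerDeriv w) k j d := by
  have hv : (((k : ℕ) : ℝ), -((j : ℕ) : ℝ))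
      = ((k : ℕ) : ℝ) • ((1, 0) : ℝ × ℝ) + (-((j : ℕ) : ℝ)) • ((0, 1) : ℝ × ℝ) := by simp
  rw [hv, iterate_dirDerivWithin_add_smul G.uniqueDiffOn_D G.D_subset_closure_interior _ _ d hw
    G.corner_mem_D, stencilTaylor, Finset.mul_sum]
  refine Finset.sum_congr rfl fun p hp => ?_
  rw [Finset.HasAntidiagonal.mem_antidiagonal] at hp
  have hd : ((p.1 + p.2).factorial : ℝ) ≠ 0 := by positivity
  rw [← hp, Nat.choose_symm_add, Nat.add_choose,
    Nat.cast_div (Nat.factorial_mul_factorial_dvd_factorial_add _ _) (by positivity)]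
  simp only [smul_eq_mul, cornerDeriv]
  push_cast
  field_simp
  rfl

theorem taylor_gridPoint (d : ℕ) (hw : ContDiffOn ℝ (d + 1 : ℕ) w G.D) (k j : Fin 2) :
    (fun N₁ : ℕ => w (G.gridPoint N₁ k j) - ∑ i ∈ Finset.range (d + 1),
        G.gridSize N₁ ^ i * stencilTaylor (G.cornerDeriv w) k j i)
      =O[atTop] (fun N₁ : ℕ => G.gridSize N₁ ^ (d + 1)) := by
  obtain ⟨δ, hδ, -, -, hsub⟩ := G.exists_square_subset_D
  have hle : ∀ l : Fin 2, ((l : ℕ) : ℝ) ≤ 1 := fun l => by exact_mod_cast Nat.lt_succ_iff.1 l.2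
  have hline : ∀ t ∈ Icc 0 δ, G.corner + t • (((k : ℕ) : ℝ), -((j : ℕ) : ℝ)) ∈ G.D := by
    intro t ht
    have hmul : ∀ l : Fin 2, 0 ≤ t * ((l : ℕ) : ℝ) ∧ t * ((l : ℕ) : ℝ) ≤ δ := fun l =>
      ⟨mul_nonneg ht.1 (Nat.cast_nonneg _), (mul_le_of_le_one_right ht.1 (hle l)).trans ht.2⟩
    refine hsub ⟨⟨?_, ?_⟩, ⟨?_, ?_⟩⟩ <;> simp only [corner, Prod.fst_add, Prod.snd_add,
      Prod.smul_fst, Prod.smul_snd, smul_eq_mul] <;> linarith [hmul k, hmul j]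
  obtain ⟨C, hC⟩ := exists_taylor_line_bound G.uniqueDiffOn_D hδ hline d hw
  refine IsBigO.of_bound C ?_
  filter_upwards [G.tendsto_gridSize.eventually (gt_mem_nhds hδ), eventually_gt_atTop 0]
    with N₁ hN₁δ hN₁
  have hpos := G.gridSize_pos hN₁
  have hsum : ∀ i ∈ Finset.range (d + 1),
      G.gridSize N₁ ^ i * stencilTaylor (G.cornerDeriv w) k j i
        = (G.gridSize N₁ ^ i / i.factorial) •
          (dirDerivWithin G.D (((k : ℕ) : ℝ), -((j : ℕ) : ℝ)))^[i] w G.corner := fun i hi => by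
    rw [iterate_dirDerivWithin_corner k j i
      (hw.of_le (by norm_cast; exact (Finset.mem_range.1 hi).le)), smul_eq_mul]
    field_simp
  rw [Real.norm_of_nonneg (by positivity : 0 ≤ G.gridSize N₁ ^ (d + 1)), gridPoint_eq hN₁,
    Finset.sum_congr rfl hsum]
  exact hC _ ⟨hpos.le, hN₁δ.le⟩

end InterfaceDomain

/-! ### Jets of solutions at the corner -/

section HomogeneousJets

variable {Q R : Type*} [AddCommGroup Q] [Module ℝ Q] [AddCommGroup R] [Module ℝ R]

theorem jetMul₁_eq_zero {b : ℕ → ℝ} {V : ℕ → Q} {n : ℕ} (hV : ∀ j ≤ n, V j = 0) :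
    jetMul₁ b V n = 0 :=
  Finset.sum_eq_zero fun q hq => by
    rw [hV _ (Finset.HasAntidiagonal.antidiagonal.snd_le hq), smul_zero]

theorem jetMul_eq_smul {a : ℕ → ℕ → ℝ} {V : ℕ → ℕ → Q} {m n : ℕ}
    (hV : ∀ i j, i + j < m + n → V i j = 0) : jetMul a V m n = a 0 0 • V m n := by
  rw [jetMul, Finset.sum_eq_single_of_mem (0, n) (by simp), Finset.sum_eq_single_of_mem (0, m)
    (by simp)]
  · simp
  · rintro ⟨i, i'⟩ hi hne
    simp only [Finset.HasAntidiagonal.mem_antidiagonal, ne_eq, Prod.mk.injEq] at hi hne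
    rw [hV _ _ (by dsimp only; omega), smul_zero]
  · rintro ⟨j, j'⟩ hj hne
    simp only [Finset.HasAntidiagonal.mem_antidiagonal, ne_eq, Prod.mk.injEq] at hj hne
    refine Finset.sum_eq_zero fun p hp => ?_
    have hp' := Finset.HasAntidiagonal.antidiagonal.snd_le hp
    rw [hV _ _ (by dsimp only; omega), smul_zero]

namespace CornerJet

variable (J : CornerJet)

/-- The partial derivatives at the corner of `f = -∇·(a∇u)`, where `U` are those of `u`. -/
noncomputable def source (U : ℕ → ℕ → Q) (m n : ℕ) : Q :=
  -(jetMul J.a (fun i j => U (i + 1) j) (m + 1) n + jetMul J.a (fun i j => U i (j + 1)) m (n + 1))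

/-- The derivatives at the corner of `g₁ = -u_x + α u` on the left side, where `U` are the partial
derivatives of `u`. -/
noncomputable def leftData (U : ℕ → ℕ → Q) (n : ℕ) : Q :=
  -U 1 n + jetMul₁ J.α (U 0) n

/-- The derivatives at the corner of `g₄ = u_y + β u` on the top side, where `U` are the partial
derivatives of `u`. -/
noncomputable def topData (U : ℕ → ℕ → Q) (m : ℕ) : Q :=
  U m 1 + jetMul₁ J.β (fun i => U i 0) m

theorem map_source (φ : Q →ₗ[ℝ] R) (U : ℕ → ℕ → Q) (m n : ℕ) :
    φ (J.source U m n) = J.source (fun i j => φ (U i j)) m n := by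
  simp only [source, map_neg, map_add, map_jetMul]

theorem map_leftData (φ : Q →ₗ[ℝ] R) (U : ℕ → ℕ → Q) (n : ℕ) :
    φ (J.leftData U n) = J.leftData (fun i j => φ (U i j)) n := by
  simp only [leftData, map_neg, map_add, map_jetMul₁]

theorem map_topData (φ : Q →ₗ[ℝ] R) (U : ℕ → ℕ → Q) (m : ℕ) :
    φ (J.topData U m) = J.topData (fun i j => φ (U i j)) m := by
  simp only [topData, map_add, map_jetMul₁]

end CornerJet

/-- The relations between the partial derivatives at the corner, up to order `N`, of a solution with
vanishing data. -/
structure IsHomogeneousJet (J : CornerJet) (N : ℕ) (U : ℕ → ℕ → Q) : Prop where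
  source : ∀ m n, m + n + 2 ≤ N → J.source U m n = 0
  left : ∀ n, n + 1 ≤ N → J.leftData U n = 0
  top : ∀ m, m + 1 ≤ N → J.topData U m = 0

/-- For even `m + n`, the partial derivatives at the origin of the harmonic polynomial
`Re (x + i y) ^ (m + n) / (m + n)!`. -/
noncomputable def harmonicJet (m n : ℕ) : ℝ := if Even m ∧ Even n then (-1) ^ (n / 2) else 0

theorem eq_harmonicJet_smul {V : ℕ → ℕ → Q} {d : ℕ}
    (laplace : ∀ m n, m + n + 2 = d → V (m + 2) n + V m (n + 2) = 0)
    (left : ∀ n, n + 1 = d → V 1 n = 0) (top : ∀ m, m + 1 = d → V m 1 = 0)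
    {m n : ℕ} (hmn : m + n = d) : V m n = harmonicJet m n • V d 0 := by
  have shift : ∀ j m n, m + n + 2 * j = d → V m (n + 2 * j) = (-1 : ℝ) ^ j • V (m + 2 * j) n := by
    intro j
    induction j with
    | zero => simp
    | succ j ih =>
      intro m n h
      have hlaplace := laplace m (n + 2 * j) (by omega)
      rw [ih (m + 2) n (by omega)] at hlaplace
      rw [mul_add_one, ← add_assoc, eq_neg_of_add_eq_zero_right hlaplace, pow_succ, mul_neg_one,
        neg_smul, add_comm (2 * j), ← add_assoc]
  obtain ⟨j, rfl | rfl⟩ := n.even_or_odd'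
  · have hn : V m (2 * j) = (-1 : ℝ) ^ j • V d 0 := by
      simpa only [zero_add, hmn] using shift j m 0 (by omega)
    obtain ⟨i, rfl | rfl⟩ := m.even_or_odd'
    · simp [harmonicJet, hn]
    · have hd : V d 0 = 0 := by
        have hx := shift (i + j) 1 0 (by omega)
        rw [zero_add, left _ (by omega), show 1 + 2 * (i + j) = d by omega] at hx
        exact (smul_eq_zero.1 hx.symm).resolve_left (by simp)
      rw [hn, hd, smul_zero, smul_zero]
  · have hodd : ¬ Even (2 * j + 1) := by simp
    rw [add_comm (2 * j), shift j m 1 (by omega), top _ (by omega), add_comm 1]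
    simp [harmonicJet, hodd]

/-- The span of the even pure derivatives in `x` of order less than `d`. -/
def lowerSpan (U : ℕ → ℕ → Q) (d : ℕ) : Submodule ℝ Q :=
  Submodule.span ℝ ((fun k => U (2 * k) 0) '' Finset.range ((d + 1) / 2))

theorem lowerSpan_mono (U : ℕ → ℕ → Q) : Monotone (lowerSpan U) := fun d d' h =>
  Submodule.span_mono <| image_mono <| Finset.coe_subset.2 <| Finset.range_subset_range.2 <| by
    omega

theorem harmonicJet_smul_mem_lowerSpan (U : ℕ → ℕ → Q) {m n d : ℕ} (h : m + n < d) :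
    harmonicJet m n • U (m + n) 0 ∈ lowerSpan U d := by
  by_cases hmn : Even m ∧ Even n
  · obtain ⟨k, hk⟩ := hmn.1.add hmn.2
    refine Submodule.smul_mem _ _ (Submodule.subset_span ⟨k, ?_, ?_⟩)
    · simp only [Finset.coe_range, mem_Iio]
      omega
    · simp only [hk, two_mul]
  · simp [harmonicJet, hmn]

namespace IsHomogeneousJet

variable {J : CornerJet} {N : ℕ} {U : ℕ → ℕ → Q}

theorem map (hU : IsHomogeneousJet J N U) (φ : Q →ₗ[ℝ] R) :
    IsHomogeneousJet J N (fun i j => φ (U i j)) where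
  source m n h := by rw [← J.map_source, hU.source m n h, map_zero]
  left n h := by rw [← J.map_leftData, hU.left n h, map_zero]
  top m h := by rw [← J.map_topData, hU.top m h, map_zero]

theorem eq_harmonicJet_smul (hU : IsHomogeneousJet J N U) (hJ : J.a 0 0 ≠ 0) {d : ℕ} (hd : d ≤ N)
    (hlow : ∀ i j, i + j < d → U i j = 0) {m n : ℕ} (hmn : m + n = d) :
    U m n = harmonicJet m n • U d 0 := by
  refine CornerFD.eq_harmonicJet_smul (fun m n h => ?_) (fun n h => ?_) (fun m h => ?_) hmn
  · have hsource := hU.source m n (by omega)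
    rw [CornerJet.source, neg_eq_zero, jetMul_eq_smul fun i j hij => hlow _ _ (by omega),
      jetMul_eq_smul fun i j hij => hlow _ _ (by omega), ← smul_add] at hsource
    exact (smul_eq_zero.1 hsource).resolve_left hJ
  · have hleft := hU.left n (by omega)
    rwa [CornerJet.leftData, jetMul₁_eq_zero fun j hj => hlow _ _ (by omega), add_zero,
      neg_eq_zero] at hleft
  · have htop := hU.top m (by omega)
    rwa [CornerJet.topData, jetMul₁_eq_zero fun j hj => hlow _ _ (by omega), add_zero] at htop

-- Modulo the derivatives of lower order the relations are those of the Neumann Laplacian.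
theorem sub_mem_lowerSpan (hU : IsHomogeneousJet J N U) (hJ : J.a 0 0 ≠ 0) (m n : ℕ)
    (hmn : m + n ≤ N) : U m n - harmonicJet m n • U (m + n) 0 ∈ lowerSpan U (m + n) := by
  induction hd : m + n using Nat.strong_induction_on generalizing m n with
  | _ d ih =>
    have hlow : ∀ i j, i + j < d → U i j ∈ lowerSpan U d := fun i j hij => by
      have hsub := lowerSpan_mono U hij.le (ih (i + j) hij i j (by omega) rfl)
      simpa only [sub_add_cancel] using
        Submodule.add_mem _ hsub (harmonicJet_smul_mem_lowerSpan U hij)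
    have hmod := (hU.map (lowerSpan U d).mkQ).eq_harmonicJet_smul hJ (hd ▸ hmn)
      (fun i j hij => (Submodule.Quotient.mk_eq_zero _).2 (hlow i j hij)) hd
    rw [← map_smul, ← sub_eq_zero, ← map_sub] at hmod
    exact (Submodule.Quotient.mk_eq_zero _).1 hmod

end IsHomogeneousJet

/-- A jet of order `d` of vanishing whose leading part is that of `Re (x + i y) ^ d / d!`. -/
structure HasHarmonicLead (V : ℕ → ℕ → ℝ) (d : ℕ) : Prop where
  lower : ∀ m n, m + n < d → V m n = 0
  lead : ∀ m n, m + n = d → V m n = harmonicJet m n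

theorem IsHomogeneousJet.exists_elimination {J : CornerJet} {N : ℕ} {U : ℕ → ℕ → Q}
    (hU : IsHomogeneousJet J N U) (hJ : J.a 0 0 ≠ 0) :
    ∃ V : ℕ → ℕ → ℕ → ℝ, (∀ k, HasHarmonicLead (V k) (2 * k)) ∧ ∀ m n, m + n ≤ N →
      U m n = ∑ k ∈ Finset.range (N / 2 + 1), V k m n • U (2 * k) 0 := by
  have hlower : ∀ m n, ∃ c : ℕ → ℝ, m + n ≤ N → ∑ k ∈ Finset.range ((m + n + 1) / 2),
      c k • U (2 * k) 0 = U m n - harmonicJet m n • U (m + n) 0 := fun m n => by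
    by_cases hmn : m + n ≤ N
    · obtain ⟨c, hc⟩ := (Submodule.mem_span_image_finset_iff_exists_fun' ℝ).1
        (hU.sub_mem_lowerSpan hJ m n hmn)
      exact ⟨c, fun _ => hc⟩
    · exact ⟨0, fun h => absurd h hmn⟩
  choose c hc using hlower
  refine ⟨fun k m n => if m + n = 2 * k then harmonicJet m n else if 2 * k < m + n then c m n k
    else 0, fun k => ⟨fun m n h => ?_, fun m n h => if_pos h⟩, fun m n hmn => ?_⟩
  · exact (if_neg h.ne).trans (if_neg h.le.not_gt)
  have hlead : harmonicJet m n • U (m + n) 0 = ∑ k ∈ Finset.range (N / 2 + 1),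
      if m + n = 2 * k then harmonicJet m n • U (2 * k) 0 else 0 := by
    by_cases he : Even m ∧ Even n
    · obtain ⟨k, hk⟩ := he.1.add he.2
      rw [hk, ← two_mul, Finset.sum_eq_single_of_mem k (Finset.mem_range.2 (by omega))
        fun l _ hl => if_neg (by omega), if_pos rfl]
    · simp [harmonicJet, he]
  rw [eq_add_of_sub_eq (hc m n hmn).symm, hlead,
    show Finset.range ((m + n + 1) / 2) = (Finset.range (N / 2 + 1)).filter (2 * · < m + n) by
      ext k; simp only [Finset.mem_range, Finset.mem_filter]; omega,
    Finset.sum_filter, ← Finset.sum_add_distrib]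
  refine Finset.sum_congr rfl fun k _ => ?_
  rcases lt_trichotomy (m + n) (2 * k) with h | h | h
  · simp [h.ne, h.le.not_gt]
  · simp [h]
  · simp [h.ne', h]

end HomogeneousJets

/-! ### The stencil -/

section Stencil

open Polynomial PowerSeries

/-- The coefficient of `h ^ d` in the Taylor expansion of the left-hand side of a scheme, where the
stencil coefficients have the Taylor coefficients `c` and `u` has the partial derivatives `U`. -/
noncomputable def stencilCoeff {Q : Type*} [AddCommGroup Q] [Module ℝ Q]
    (c : Fin 2 → Fin 2 → ℕ → ℝ) (U : ℕ → ℕ → Q) (d : ℕ) : Q :=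
  ∑ k, ∑ j, ∑ e ∈ Finset.HasAntidiagonal.antidiagonal d, c k j e.1 • stencilTaylor U k j e.2

theorem map_stencilCoeff {Q R : Type*} [AddCommGroup Q] [Module ℝ Q] [AddCommGroup R] [Module ℝ R]
    (φ : Q →ₗ[ℝ] R) (c : Fin 2 → Fin 2 → ℕ → ℝ) (U : ℕ → ℕ → Q) (d : ℕ) :
    φ (stencilCoeff c U d) = stencilCoeff c (fun m n => φ (U m n)) d := by
  simp only [stencilCoeff, map_sum, map_smul, map_stencilTaylor]

theorem stencilTaylor_congr {Q : Type*} [AddCommGroup Q] [Module ℝ Q] {U U' : ℕ → ℕ → Q} {d : ℕ}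
    (h : ∀ m n, m + n = d → U m n = U' m n) (k j : Fin 2) :
    stencilTaylor U k j d = stencilTaylor U' k j d :=
  Finset.sum_congr rfl fun p hp => by
    rw [h _ _ (Finset.HasAntidiagonal.mem_antidiagonal.1 hp)]

theorem stencilCoeff_congr {Q : Type*} [AddCommGroup Q] [Module ℝ Q]
    {c c' : Fin 2 → Fin 2 → ℕ → ℝ} {U U' : ℕ → ℕ → Q} {d : ℕ}
    (hc : ∀ k j, ∀ e ≤ d, c k j e = c' k j e) (hU : ∀ m n, m + n ≤ d → U m n = U' m n) :
    stencilCoeff c U d = stencilCoeff c' U' d := by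
  refine Finset.sum_congr rfl fun k _ => Finset.sum_congr rfl fun j _ =>
    Finset.sum_congr rfl fun e he => ?_
  have hsnd := Finset.HasAntidiagonal.antidiagonal.snd_le he
  rw [hc k j _ (Finset.HasAntidiagonal.antidiagonal.fst_le he),
    stencilTaylor_congr fun m n h => hU m n (h.trans_le hsnd)]

theorem stencilCoeff_sum_smul {Q ι : Type*} [AddCommGroup Q] [Module ℝ Q]
    (c : Fin 2 → Fin 2 → ℕ → ℝ) (I : Finset ι) (V : ι → ℕ → ℕ → ℝ) (v : ι → Q) (d : ℕ) :
    stencilCoeff c (fun m n => ∑ i ∈ I, V i m n • v i) d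
      = ∑ i ∈ I, stencilCoeff c (V i) d • v i := by
  have hsum := map_stencilCoeff (∑ i ∈ I, (LinearMap.proj (R := ℝ) i).smulRight (v i) :
    (ι → ℝ) →ₗ[ℝ] Q) c (fun m n i => V i m n) d
  simp only [LinearMap.sum_apply, LinearMap.smulRight_apply, LinearMap.proj_apply] at hsum
  rw [← hsum]
  refine Finset.sum_congr rfl fun i _ => ?_
  exact congrArg (· • v i) (map_stencilCoeff (LinearMap.proj i : (ι → ℝ) →ₗ[ℝ] ℝ) c
    (fun m n i => V i m n) d)

/-- The formal Taylor expansion in `h` of the value at the stencil point `(k h, -j h)` of a function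
with partial derivatives `V` at the origin. -/
noncomputable def stencilSeries (V : ℕ → ℕ → ℝ) (k j : Fin 2) : ℝ⟦X⟧ :=
  PowerSeries.mk (stencilTaylor V k j)

theorem stencilCoeff_eq_coeff (c : Fin 2 → Fin 2 → ℝ⟦X⟧) (V : ℕ → ℕ → ℝ) (d : ℕ) :
    stencilCoeff (fun k j e => PowerSeries.coeff e (c k j)) V d
      = PowerSeries.coeff d (∑ k, ∑ j, c k j * stencilSeries V k j) := by
  simp only [stencilCoeff, map_sum, PowerSeries.coeff_mul, stencilSeries, PowerSeries.coeff_mk,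
    smul_eq_mul]

theorem stencilSeries_zero_zero (V : ℕ → ℕ → ℝ) :
    stencilSeries V 0 0 = PowerSeries.C (V 0 0) := by
  ext d
  rw [stencilSeries, PowerSeries.coeff_mk, PowerSeries.coeff_C]
  split_ifs with hd
  · simp [hd, stencilTaylor]
  · refine Finset.sum_eq_zero fun p hp => ?_
    rw [Finset.HasAntidiagonal.mem_antidiagonal] at hp
    have : p.1 ≠ 0 ∨ p.2 ≠ 0 := by omega
    rcases this with h | h <;> simp [h]

theorem HasHarmonicLead.exists_stencilSeries_eq {V : ℕ → ℕ → ℝ} {d : ℕ} (hV : HasHarmonicLead V d)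
    (k j : Fin 2) : ∃ P : ℝ⟦X⟧, stencilSeries V k j = PowerSeries.X ^ d * P ∧
      PowerSeries.constantCoeff P = stencilTaylor harmonicJet k j d := by
  obtain ⟨P, hP⟩ : PowerSeries.X ^ d ∣ stencilSeries V k j :=
    PowerSeries.X_pow_dvd_iff.2 fun e he => by
      rw [stencilSeries, PowerSeries.coeff_mk]
      refine Finset.sum_eq_zero fun p hp => ?_
      rw [Finset.HasAntidiagonal.mem_antidiagonal] at hp
      rw [hV.lower _ _ (hp.trans_lt he), smul_zero]
  have hcoeff := congrArg (PowerSeries.coeff d) hP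
  rw [stencilSeries, PowerSeries.coeff_mk, stencilTaylor_congr hV.lead] at hcoeff
  exact ⟨P, hP, by simpa [PowerSeries.coeff_X_pow_mul'] using hcoeff.symm⟩

theorem stencilTaylor_harmonicJet_one_zero (i : ℕ) :
    stencilTaylor harmonicJet 1 0 (2 * i) = 1 / (2 * i).factorial := by
  rw [stencilTaylor, Finset.sum_eq_single_of_mem (2 * i, 0) (by simp)]
  · simp [harmonicJet]
  · rintro ⟨m, n⟩ hmn hne
    have hn : n ≠ 0 := by
      rintro rfl
      simp_all
    simp [hn]

theorem stencilTaylor_harmonicJet_zero_one (i : ℕ) :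
    stencilTaylor harmonicJet 0 1 (2 * i) = (-1) ^ i / (2 * i).factorial := by
  rw [stencilTaylor, Finset.sum_eq_single_of_mem (0, 2 * i) (by simp)]
  · simp [harmonicJet, div_eq_inv_mul]
  · rintro ⟨m, n⟩ hmn hne
    have hm : m ≠ 0 := by
      rintro rfl
      simp_all
    simp [hm]

-- `Re (1 - i) ^ (2 i) / (2 i)!` for `i = 0, 1, 2, 3`.
theorem stencilTaylor_harmonicJet_one_one :
    stencilTaylor harmonicJet 1 1 0 = 1 ∧ stencilTaylor harmonicJet 1 1 2 = 0 ∧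
      stencilTaylor harmonicJet 1 1 4 = -1 / 6 ∧ stencilTaylor harmonicJet 1 1 6 = 0 := by
  have hantidiagonal : ∀ d (g : ℕ × ℕ → ℝ), ∑ p ∈ Finset.HasAntidiagonal.antidiagonal d, g p
      = ∑ m ∈ Finset.range (d + 1), g (m, d - m) :=
    fun d g => Finset.Nat.sum_antidiagonal_eq_sum_range_succ_mk g d
  simp only [stencilTaylor, hantidiagonal]
  norm_num [Finset.sum_range_succ, harmonicJet, Nat.factorial, Nat.even_iff]

-- The vector `(c₁, c₂, c₃)` is the cross product of the values of the harmonic polynomials of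
-- degrees two and four at the stencil points off the corner.  In degree six it is orthogonal only
-- to their leading values `(1, -1, 0) / 6!`, which is enough for a divisibility by `X ^ 7`.
theorem exists_stencil_off_corner {V : ℕ → ℕ → ℕ → ℝ}
    (hV : ∀ i, HasHarmonicLead (V i) (2 * i)) : ∃ c₁ c₂ c₃ : ℝ⟦X⟧,
      PowerSeries.constantCoeff c₁ = 1 / 12 ∧ PowerSeries.constantCoeff c₂ = 1 / 12 ∧
      PowerSeries.constantCoeff c₃ = 1 / 24 ∧ ∀ i, 0 < i → i < 4 → PowerSeries.X ^ 7 ∣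
        c₁ * stencilSeries (V i) 1 0 + c₂ * stencilSeries (V i) 0 1
          + c₃ * stencilSeries (V i) 1 1 := by
  choose P hP hP₀ using fun i => (hV i).exists_stencilSeries_eq
  obtain ⟨-, h₁, h₂, h₃⟩ := stencilTaylor_harmonicJet_one_one
  have hconst₁ : PowerSeries.constantCoeff (P 1 0 1 * P 2 1 1 - P 1 1 1 * P 2 0 1) = 1 / 12 := by
    simp only [map_sub, map_mul, hP₀, stencilTaylor_harmonicJet_zero_one, h₁, h₂]
    norm_num
  have hconst₂ : PowerSeries.constantCoeff (P 1 1 1 * P 2 1 0 - P 1 1 0 * P 2 1 1) = 1 / 12 := by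
    simp only [map_sub, map_mul, hP₀, stencilTaylor_harmonicJet_one_zero, h₁, h₂]
    norm_num [Nat.factorial]
  have hconst₃ : PowerSeries.constantCoeff (P 1 1 0 * P 2 0 1 - P 1 0 1 * P 2 1 0) = 1 / 24 := by
    simp only [map_sub, map_mul, hP₀, stencilTaylor_harmonicJet_one_zero,
      stencilTaylor_harmonicJet_zero_one]
    norm_num [Nat.factorial]
  refine ⟨_, _, _, hconst₁, hconst₂, hconst₃, fun i hi hi₄ => ?_⟩
  simp only [hP i]
  obtain rfl | rfl | rfl : i = 1 ∨ i = 2 ∨ i = 3 := by omega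
  · exact ⟨0, by ring⟩
  · exact ⟨0, by ring⟩
  · obtain ⟨R, hR⟩ : PowerSeries.X ∣ (P 1 0 1 * P 2 1 1 - P 1 1 1 * P 2 0 1) * P 3 1 0
        + (P 1 1 1 * P 2 1 0 - P 1 1 0 * P 2 1 1) * P 3 0 1
        + (P 1 1 0 * P 2 0 1 - P 1 0 1 * P 2 1 0) * P 3 1 1 := by
      rw [PowerSeries.X_dvd_iff, map_add, map_add, map_mul, map_mul, map_mul, hconst₁, hconst₂,
        hconst₃, hP₀, hP₀, hP₀, stencilTaylor_harmonicJet_one_zero,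
        stencilTaylor_harmonicJet_zero_one, h₃]
      ring
    exact ⟨R, by linear_combination (PowerSeries.X : ℝ⟦X⟧) ^ 6 * hR⟩

theorem exists_powerSeries_stencil {V : ℕ → ℕ → ℕ → ℝ} (hV : ∀ i, HasHarmonicLead (V i) (2 * i)) :
    ∃ c : Fin 2 → Fin 2 → ℝ⟦X⟧, (∀ k j, PowerSeries.constantCoeff (c k j) ≠ 0) ∧
      ∀ i < 4, PowerSeries.X ^ 7 ∣ ∑ k, ∑ j, c k j * stencilSeries (V i) k j := by
  obtain ⟨c₁, c₂, c₃, h₁, h₂, h₃, hdvd⟩ := exists_stencil_off_corner hV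
  have hone : ∀ k j, PowerSeries.constantCoeff (stencilSeries (V 0) k j) = 1 := fun k j => by
    have hV₀ : V 0 0 0 = 1 := by simp [(hV 0).lead 0 0 rfl, harmonicJet]
    simp [stencilSeries, ← PowerSeries.coeff_zero_eq_constantCoeff_apply, stencilTaylor, hV₀]
  set c₀ := -(c₁ * stencilSeries (V 0) 1 0 + c₂ * stencilSeries (V 0) 0 1
    + c₃ * stencilSeries (V 0) 1 1) with hc₀
  have h₀ : PowerSeries.constantCoeff c₀ = -5 / 24 := by
    simp only [hc₀, map_neg, map_add, map_mul, hone, h₁, h₂, h₃]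
    norm_num
  refine ⟨![![c₀, c₂], ![c₁, c₃]], fun k j => ?_, fun i hi => ?_⟩
  · fin_cases k <;> fin_cases j <;> simp [h₀, h₁, h₂, h₃]
  simp only [Fin.sum_univ_two, Matrix.cons_val_zero, Matrix.cons_val_one, stencilSeries_zero_zero]
  rcases i.eq_zero_or_pos with rfl | hpos
  · rw [(hV 0).lead 0 0 rfl]
    exact ⟨0, by simp only [harmonicJet, hc₀]; simp; ring⟩
  · rw [(hV i).lower 0 0 (by omega), map_zero, mul_zero, zero_add, add_left_comm, ← add_assoc]
    exact hdvd i hpos hi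

theorem exists_polynomial_stencil {V : ℕ → ℕ → ℕ → ℝ} (hV : ∀ i, HasHarmonicLead (V i) (2 * i)) :
    ∃ C : Fin 2 → Fin 2 → ℝ[X], (∀ k j, (C k j).natDegree ≤ 6) ∧ (∀ k j, (C k j).eval 0 ≠ 0) ∧
      ∀ i < 4, ∀ d < 7, stencilCoeff (fun k j => (C k j).coeff) (V i) d = 0 := by
  obtain ⟨c, hc, hdvd⟩ := exists_powerSeries_stencil hV
  refine ⟨fun k j => (c k j).trunc 7, fun k j => ?_, fun k j => ?_, fun i hi d hd => ?_⟩
  · exact Nat.lt_succ_iff.1 ((c k j).natDegree_trunc_lt 6)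
  · rw [← coeff_zero_eq_eval_zero, PowerSeries.coeff_trunc, if_pos (by norm_num)]
    simpa using hc k j
  · rw [← PowerSeries.X_pow_dvd_iff.1 (hdvd i hi) d hd, ← stencilCoeff_eq_coeff]
    exact stencilCoeff_congr (fun k j e he => by
      rw [PowerSeries.coeff_trunc, if_pos (he.trans_lt hd)]) fun _ _ _ => rfl

theorem IsHomogeneousJet.exists_polynomial_stencil {Q : Type*} [AddCommGroup Q] [Module ℝ Q]
    {J : CornerJet} {U : ℕ → ℕ → Q} (hU : IsHomogeneousJet J 6 U) (hJ : J.a 0 0 ≠ 0) :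
    ∃ C : Fin 2 → Fin 2 → ℝ[X], (∀ k j, (C k j).natDegree ≤ 6) ∧ (∀ k j, (C k j).eval 0 ≠ 0) ∧
      ∀ d < 7, stencilCoeff (fun k j => (C k j).coeff) U d = 0 := by
  obtain ⟨V, hV, hUV⟩ := hU.exists_elimination hJ
  obtain ⟨C, hdeg, hC₀, hC⟩ := CornerFD.exists_polynomial_stencil hV
  refine ⟨C, hdeg, hC₀, fun d hd => ?_⟩
  rw [stencilCoeff_congr (fun _ _ _ _ => rfl) fun m n hmn => hUV m n (by omega),
    stencilCoeff_sum_smul]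
  exact Finset.sum_eq_zero fun i hi => by rw [hC i (Finset.mem_range.1 hi) d hd, zero_smul]

end Stencil

section UniversalJet

variable {Q R : Type*} [AddCommGroup Q] [Module ℝ Q] [AddCommGroup R] [Module ℝ R]

/-- The right-hand side of a scheme, linear in its coefficients: the combination of the derivatives
`F` of `f` of orders less than `M` and of the derivatives `G₁`, `G₄` of `g₁`, `g₄` of orders at most
`M`. -/
noncomputable def dataCombination (M : ℕ) (F : ℕ → ℕ → Q) (G₁ G₄ : ℕ → Q) :
    ((ℕ → ℕ → ℝ) × (ℕ → ℝ) × (ℕ → ℝ)) →ₗ[ℝ] Q where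
  toFun c := ∑ d ∈ Finset.range M, ∑ q ∈ Finset.HasAntidiagonal.antidiagonal d,
      c.1 q.1 q.2 • F q.1 q.2
    + ∑ n ∈ Finset.range (M + 1), c.2.1 n • G₁ n + ∑ n ∈ Finset.range (M + 1), c.2.2 n • G₄ n
  map_add' c c' := by
    simp only [Prod.fst_add, Prod.snd_add, Pi.add_apply, add_smul, Finset.sum_add_distrib]
    abel
  map_smul' r c := by
    simp only [Prod.smul_fst, Prod.smul_snd, Pi.smul_apply, smul_assoc, Finset.smul_sum, smul_add,
      RingHom.id_apply]

theorem dataCombination_apply (M : ℕ) (F : ℕ → ℕ → Q) (G₁ G₄ : ℕ → Q)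
    (c : (ℕ → ℕ → ℝ) × (ℕ → ℝ) × (ℕ → ℝ)) : dataCombination M F G₁ G₄ c
      = ∑ d ∈ Finset.range M, ∑ q ∈ Finset.HasAntidiagonal.antidiagonal d, c.1 q.1 q.2 • F q.1 q.2
        + ∑ n ∈ Finset.range (M + 1), c.2.1 n • G₁ n
        + ∑ n ∈ Finset.range (M + 1), c.2.2 n • G₄ n :=
  rfl

theorem map_dataCombination (φ : Q →ₗ[ℝ] R) (M : ℕ) (F : ℕ → ℕ → Q) (G₁ G₄ : ℕ → Q)
    (c : (ℕ → ℕ → ℝ) × (ℕ → ℝ) × (ℕ → ℝ)) : φ (dataCombination M F G₁ G₄ c)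
      = dataCombination M (fun m n => φ (F m n)) (fun n => φ (G₁ n)) (fun n => φ (G₄ n)) c := by
  simp only [dataCombination_apply, map_add, map_sum, map_smul]

section Range

variable (F : ℕ → ℕ → Q) (G₁ G₄ : ℕ → Q) {M m n : ℕ}

theorem source_mem_range_dataCombination (h : m + n < M) :
    F m n ∈ LinearMap.range (dataCombination M F G₁ G₄) := by
  refine ⟨(fun i j => if (i, j) = (m, n) then 1 else 0, 0, 0), ?_⟩
  simp only [dataCombination_apply, Pi.zero_apply, zero_smul, Finset.sum_const_zero, add_zero,
    ite_smul, one_smul, Prod.mk.eta, Finset.sum_ite_eq', Finset.HasAntidiagonal.mem_antidiagonal]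
  simp [h]

theorem left_mem_range_dataCombination (h : n ≤ M) :
    G₁ n ∈ LinearMap.range (dataCombination M F G₁ G₄) :=
  ⟨(0, fun i => if i = n then 1 else 0, 0), by
    simp [dataCombination_apply, Nat.lt_succ_iff.2 h]⟩

theorem top_mem_range_dataCombination (h : n ≤ M) :
    G₄ n ∈ LinearMap.range (dataCombination M F G₁ G₄) :=
  ⟨(0, 0, fun i => if i = n then 1 else 0), by
    simp [dataCombination_apply, Nat.lt_succ_iff.2 h]⟩

end Range

theorem isHomogeneousJet_mkQ (J : CornerJet) (M : ℕ) (U : ℕ → ℕ → Q) :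
    IsHomogeneousJet J (M + 1) (fun m n => (LinearMap.range (dataCombination M (J.source U)
      (J.leftData U) (J.topData U))).mkQ (U m n)) where
  source m n h := by
    rw [← J.map_source, Submodule.mkQ_apply, Submodule.Quotient.mk_eq_zero]
    exact source_mem_range_dataCombination _ _ _ (by omega)
  left n h := by
    rw [← J.map_leftData, Submodule.mkQ_apply, Submodule.Quotient.mk_eq_zero]
    exact left_mem_range_dataCombination _ _ _ (by omega)
  top m h := by
    rw [← J.map_topData, Submodule.mkQ_apply, Submodule.Quotient.mk_eq_zero]
    exact top_mem_range_dataCombination _ _ _ (by omega)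

open Polynomial in
theorem exists_stencil_eq_dataCombination {J : CornerJet} (hJ : J.a 0 0 ≠ 0) :
    ∃ C : Fin 2 → Fin 2 → ℝ[X], (∀ k j, (C k j).natDegree ≤ 6) ∧ (∀ k j, (C k j).eval 0 ≠ 0) ∧
      ∃ c : ℕ → (ℕ → ℕ → ℝ) × (ℕ → ℝ) × (ℕ → ℝ), ∀ (u : ℕ → ℕ → ℝ), ∀ d < 7,
        stencilCoeff (fun k j => (C k j).coeff) u d
          = dataCombination 5 (J.source u) (J.leftData u) (J.topData u) (c d) := by
  -- The jet with independent derivatives: modulo its data it is homogeneous, and every `u` is an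
  -- image of it.
  let U : ℕ → ℕ → ℕ × ℕ →₀ ℝ := fun m n => Finsupp.single (m, n) 1
  obtain ⟨C, hdeg, hC₀, hC⟩ := (isHomogeneousJet_mkQ J 5 U).exists_polynomial_stencil hJ
  have hrange : ∀ d, ∃ c, d < 7 → dataCombination 5 (J.source U) (J.leftData U) (J.topData U) c
      = stencilCoeff (fun k j => (C k j).coeff) U d := fun d => by
    by_cases hd : d < 7
    · have hmem := hC d hd
      rw [← map_stencilCoeff, Submodule.mkQ_apply, Submodule.Quotient.mk_eq_zero] at hmem
      exact hmem.imp fun _ hc _ => hc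
    · exact ⟨0, fun h => absurd h hd⟩
  choose c hc using hrange
  refine ⟨C, hdeg, hC₀, c, fun u d hd => ?_⟩
  have himage := congrArg (Finsupp.linearCombination ℝ fun p : ℕ × ℕ => u p.1 p.2) (hc d hd).symm
  simpa only [map_stencilCoeff, map_dataCombination, J.map_source, J.map_leftData, J.map_topData,
    U, Finsupp.linearCombination_single, one_smul] using himage

end UniversalJet

section PolynomialScheme

open Polynomial

theorem stencil_eval_sub_eq (C : Fin 2 → Fin 2 → ℝ[X]) (u : ℕ → ℕ → ℝ) (d : ℕ) :
    ∃ P : ℝ[X], ∀ h : ℝ, ∑ k, ∑ j, (C k j).eval h *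
        ∑ i ∈ Finset.range d, h ^ i * stencilTaylor u k j i
      - ∑ i ∈ Finset.range d, h ^ i * stencilCoeff (fun k j => (C k j).coeff) u i
      = h ^ d * P.eval h := by
  let T : (ℕ → ℝ) → ℝ[X] := fun b => ∑ i ∈ Finset.range d, monomial i (b i)
  have hT : ∀ b, ∀ i < d, (T b).coeff i = b i := fun b i hi => by
    simp [T, finsetSum_coeff, coeff_monomial, hi]
  have hTeval : ∀ b h, (T b).eval h = ∑ i ∈ Finset.range d, h ^ i * b i := fun b h => by
    simp only [T, eval_finsetSum, eval_monomial, mul_comm]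
  obtain ⟨P, hP⟩ : X ^ d ∣ ∑ k, ∑ j, C k j * T (stencilTaylor u k j)
      - T (stencilCoeff (fun k j => (C k j).coeff) u) := by
    refine X_pow_dvd_iff.2 fun i hi => ?_
    rw [coeff_sub, hT _ i hi, sub_eq_zero]
    simp only [finsetSum_coeff, coeff_mul, stencilCoeff, smul_eq_mul]
    refine Finset.sum_congr rfl fun k _ => Finset.sum_congr rfl fun j _ =>
      Finset.sum_congr rfl fun e he => ?_
    rw [hT _ _ ((Finset.HasAntidiagonal.antidiagonal.snd_le he).trans_lt hi)]
  refine ⟨P, fun h => ?_⟩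
  simpa only [eval_sub, eval_finsetSum, eval_mul, eval_pow, eval_X, hTeval]
    using congrArg (Polynomial.eval h) hP

namespace CornerScheme

variable (C : Fin 2 → Fin 2 → ℝ[X]) (c : ℕ → (ℕ → ℕ → ℝ) × (ℕ → ℝ) × (ℕ → ℝ))

/-- The scheme with stencil coefficients `C` whose right-hand side has the Taylor coefficients
`c 0, …, c 6` in `h`. -/
noncomputable def ofPolynomial : CornerScheme where
  M := 5
  C k j h := (C k j).eval h
  Cf m n h := ∑ d ∈ Finset.range 7, h ^ d * (c d).1 m n
  Cg₁ n h := ∑ d ∈ Finset.range 7, h ^ d * (c d).2.1 n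
  Cg₄ n h := ∑ d ∈ Finset.range 7, h ^ d * (c d).2.2 n

theorem isPolynomial_ofPolynomial {C} {D : ℕ} (hC : ∀ k j, (C k j).natDegree ≤ D) :
    (ofPolynomial C c).IsPolynomial D := by
  have hpoly : ∀ b : ℕ → ℝ, ∃ P : ℝ[X], ∀ h, ∑ d ∈ Finset.range 7, h ^ d * b d = P.eval h :=
    fun b => ⟨∑ d ∈ Finset.range 7, X ^ d * Polynomial.C (b d), fun h => by
      simp only [eval_finsetSum, eval_mul, eval_pow, eval_X, eval_C]⟩
  exact ⟨fun k j => ⟨C k j, hC k j, fun _ => rfl⟩, fun m n => hpoly fun d => (c d).1 m n,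
    fun n => hpoly fun d => (c d).2.1 n, fun n => hpoly fun d => (c d).2.2 n⟩

theorem rhs_ofPolynomial (G : InterfaceDomain) (f : ℝ × ℝ → ℝ) (g₁ g₄ : ℝ → ℝ) (N₁ : ℕ) :
    (ofPolynomial C c).rhs G f g₁ g₄ N₁ = ∑ d ∈ Finset.range 7, G.gridSize N₁ ^ d *
      dataCombination 5 (G.cornerDeriv f) (G.leftDeriv g₁) (G.topDeriv g₄) (c d) := by
  simp only [← smul_eq_mul, ← map_smul]
  rw [← map_sum, dataCombination_apply]
  simp only [rhs, ofPolynomial, Prod.fst_sum, Prod.snd_sum, Finset.sum_apply, Prod.smul_fst,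
    Prod.smul_snd, Pi.smul_apply, smul_eq_mul, mul_comm]

end CornerScheme

end PolynomialScheme

/-! ### The sixth-order scheme -/

section JetCongr

variable {Q : Type*} [AddCommGroup Q] [Module ℝ Q]

theorem jetMul₁_congr {b b' : ℕ → ℝ} {U U' : ℕ → Q} {n : ℕ} (hb : ∀ i ≤ n, b i = b' i)
    (hU : ∀ i ≤ n, U i = U' i) : jetMul₁ b U n = jetMul₁ b' U' n :=
  Finset.sum_congr rfl fun q hq => by
    rw [hb _ (Finset.HasAntidiagonal.antidiagonal.fst_le hq),
      hU _ (Finset.HasAntidiagonal.antidiagonal.snd_le hq)]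

theorem jetMul_congr {a a' : ℕ → ℕ → ℝ} {U U' : ℕ → ℕ → Q} {m n : ℕ}
    (ha : ∀ i ≤ m, ∀ j ≤ n, a i j = a' i j) (hU : ∀ i ≤ m, ∀ j ≤ n, U i j = U' i j) :
    jetMul a U m n = jetMul a' U' m n :=
  Finset.sum_congr rfl fun q hq => Finset.sum_congr rfl fun p hp => by
    rw [ha _ (Finset.HasAntidiagonal.antidiagonal.fst_le hp) _
        (Finset.HasAntidiagonal.antidiagonal.fst_le hq),
      hU _ (Finset.HasAntidiagonal.antidiagonal.snd_le hp) _
        (Finset.HasAntidiagonal.antidiagonal.snd_le hq)]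

theorem jetMul_zero_left_index (a : ℕ → ℕ → ℝ) (U : ℕ → ℕ → Q) (n : ℕ) :
    jetMul a U 0 n = jetMul₁ (a 0) (U 0) n := by
  simp [jetMul, jetMul₁]

theorem jetMul_zero_right_index (a : ℕ → ℕ → ℝ) (U : ℕ → ℕ → Q) (m : ℕ) :
    jetMul a U m 0 = jetMul₁ (fun i => a i 0) (fun i => U i 0) m := by
  simp [jetMul, jetMul₁]

theorem dataCombination_congr {M : ℕ} {F F' : ℕ → ℕ → Q} {G₁ G₁' G₄ G₄' : ℕ → Q}
    (hF : ∀ m n, m + n < M → F m n = F' m n) (hG₁ : ∀ n ≤ M, G₁ n = G₁' n)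
    (hG₄ : ∀ n ≤ M, G₄ n = G₄' n) :
    dataCombination M F G₁ G₄ = dataCombination M F' G₁' G₄' := by
  refine LinearMap.ext fun c => ?_
  simp only [dataCombination_apply]
  refine congrArg₂ (· + ·) (congrArg₂ (· + ·) ?_ ?_) ?_
  · refine Finset.sum_congr rfl fun d hd => Finset.sum_congr rfl fun q hq => ?_
    rw [hF _ _ ((Finset.HasAntidiagonal.mem_antidiagonal.1 hq).trans_lt (Finset.mem_range.1 hd))]
  · exact Finset.sum_congr rfl fun n hn => by rw [hG₁ n (Finset.mem_range_succ_iff.1 hn)]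
  · exact Finset.sum_congr rfl fun n hn => by rw [hG₄ n (Finset.mem_range_succ_iff.1 hn)]

end JetCongr

theorem InterfaceDomain.cornerDeriv_linearCombination {G : InterfaceDomain} {w w' : ℝ × ℝ → ℝ}
    (r r' : ℝ) {m n : ℕ} (hw : ContDiffOn ℝ (m + n : ℕ) w G.D)
    (hw' : ContDiffOn ℝ (m + n : ℕ) w' G.D) :
    G.cornerDeriv (fun p => r * w p + r' * w' p) m n
      = r * G.cornerDeriv w m n + r' * G.cornerDeriv w' m n := by
  simpa using cornerDeriv_sum Finset.univ ![r, r'] ![w, w'] m n (by simpa using ⟨hw, hw'⟩)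

section CornerData

variable {G : InterfaceDomain} {c : Coeffs} {M k : ℕ} {u f : ℝ × ℝ → ℝ} {g₁ g₄ : ℝ → ℝ}

theorem Coeffs.IsRegular.contDiffOn_a (hc : c.IsRegular G M) (hk : k ≤ M + 1) :
    ContDiffOn ℝ k c.a G.D :=
  hc.a_smooth.of_le (by exact_mod_cast hk)

theorem Coeffs.IsRegular.contDiffOn_α_snd (hc : c.IsRegular G M) (hk : k ≤ M) :
    ContDiffOn ℝ k (fun p : ℝ × ℝ => c.α p.2) G.D :=
  (hc.α_smooth.of_le (by exact_mod_cast hk)).comp contDiff_snd.contDiffOn fun _ hp =>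
    (G.D_subset_prod_Icc hp).2

theorem Coeffs.IsRegular.contDiffOn_β_fst (hc : c.IsRegular G M) (hk : k ≤ M) :
    ContDiffOn ℝ k (fun p : ℝ × ℝ => c.β p.1) G.D :=
  (hc.β_smooth.of_le (by exact_mod_cast hk)).comp contDiff_fst.contDiffOn fun _ hp =>
    (G.D_subset_prod_Icc hp).1

namespace IsSolution

theorem contDiffOn (hs : IsSolution G c M u f g₁ g₄) (hk : k ≤ M + 2) : ContDiffOn ℝ k u G.D :=
  hs.u_smooth.of_le (by exact_mod_cast hk)

theorem contDiffOn_pdx (hs : IsSolution G c M u f g₁ g₄) (hk : k ≤ M + 1) :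
    ContDiffOn ℝ k (G.pdx u) G.D :=
  InterfaceDomain.contDiffOn_pdx (hs.contDiffOn (Nat.succ_le_succ hk)) (by norm_cast)

theorem contDiffOn_pdy (hs : IsSolution G c M u f g₁ g₄) (hk : k ≤ M + 1) :
    ContDiffOn ℝ k (G.pdy u) G.D :=
  InterfaceDomain.contDiffOn_pdy (hs.contDiffOn (Nat.succ_le_succ hk)) (by norm_cast)

theorem contDiffOn_pdx_flux (hc : c.IsRegular G M) (hs : IsSolution G c M u f g₁ g₄)
    (hk : k ≤ M) : ContDiffOn ℝ k (G.pdx fun q => c.a q * G.pdx u q) G.D :=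
  InterfaceDomain.contDiffOn_pdx (n := (k + 1 : ℕ))
    ((hc.contDiffOn_a (Nat.succ_le_succ hk)).mul (hs.contDiffOn_pdx (Nat.succ_le_succ hk)))
    (by norm_cast)

theorem contDiffOn_pdy_flux (hc : c.IsRegular G M) (hs : IsSolution G c M u f g₁ g₄)
    (hk : k ≤ M) : ContDiffOn ℝ k (G.pdy fun q => c.a q * G.pdy u q) G.D :=
  InterfaceDomain.contDiffOn_pdy (n := (k + 1 : ℕ))
    ((hc.contDiffOn_a (Nat.succ_le_succ hk)).mul (hs.contDiffOn_pdy (Nat.succ_le_succ hk)))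
    (by norm_cast)

theorem eqOn_D (hc : c.IsRegular G M) (hs : IsSolution G c M u f g₁ g₄) :
    EqOn f (fun p => -1 * G.pdx (fun q => c.a q * G.pdx u q) p
      + -1 * G.pdy (fun q => c.a q * G.pdy u q) p) G.D := by
  refine EqOn.of_subset_closure (s := G.Ω \ closure G.ΓI) (fun p hp => ?_)
    hs.f_smooth.continuousOn ?_ (sdiff_subset_sdiff_left subset_closure) G.D_subset_closure_Ω_diff
  · rw [← hs.pde p ⟨hp.1, fun h => hp.2 (subset_closure h)⟩]
    ring
  · exact (continuousOn_const.mul (hs.contDiffOn_pdx_flux hc le_rfl).continuousOn).add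
      (continuousOn_const.mul (hs.contDiffOn_pdy_flux hc le_rfl).continuousOn)

theorem cornerDeriv_eq_source (hc : c.IsRegular G M) (hs : IsSolution G c M u f g₁ g₄) {m n : ℕ}
    (h : m + n < M) : G.cornerDeriv f m n = (c.jet G M).source (G.cornerDeriv u) m n := by
  have hx : G.cornerDeriv (G.pdx fun q => c.a q * G.pdx u q) m n
      = jetMul (c.jet G M).a (fun i j => G.cornerDeriv u (i + 1) j) (m + 1) n := by
    rw [InterfaceDomain.cornerDeriv_pdx m n
        ((hc.contDiffOn_a (by omega)).mul (hs.contDiffOn_pdx (by omega))),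
      InterfaceDomain.cornerDeriv_mul (m + 1) n (hc.contDiffOn_a (by omega))
        (hs.contDiffOn_pdx (by omega))]
    exact jetMul_congr (fun i hi j hj => (if_pos (by omega)).symm) fun i hi j hj =>
      InterfaceDomain.cornerDeriv_pdx i j (hs.contDiffOn (by omega))
  have hy : G.cornerDeriv (G.pdy fun q => c.a q * G.pdy u q) m n
      = jetMul (c.jet G M).a (fun i j => G.cornerDeriv u i (j + 1)) m (n + 1) := by
    rw [InterfaceDomain.cornerDeriv_pdy,
      InterfaceDomain.cornerDeriv_mul m (n + 1) (hc.contDiffOn_a (by omega))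
        (hs.contDiffOn_pdy (by omega))]
    exact jetMul_congr (fun i hi j hj => (if_pos (by omega)).symm) fun i _ j _ =>
      InterfaceDomain.cornerDeriv_pdy i j
  rw [InterfaceDomain.cornerDeriv_congr (hs.eqOn_D hc) m n,
    InterfaceDomain.cornerDeriv_linearCombination _ _ (hs.contDiffOn_pdx_flux hc (by omega))
      (hs.contDiffOn_pdy_flux hc (by omega)), hx, hy, CornerJet.source]
  ring

theorem leftDeriv_eq_leftData (hc : c.IsRegular G M) (hs : IsSolution G c M u f g₁ g₄) {n : ℕ}
    (h : n ≤ M) : G.leftDeriv g₁ n = (c.jet G M).leftData (G.cornerDeriv u) n := by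
  have hα : ∀ i ≤ n, G.cornerDeriv (fun p => c.α p.2) 0 i = (c.jet G M).α i := fun i hi => by
    rw [← InterfaceDomain.leftDeriv_eq_cornerDeriv i (hc.contDiffOn_α_snd (hi.trans h))
      hc.α_smooth.continuousOn fun _ _ => rfl]
    exact (if_pos (hi.trans h)).symm
  have hpdx : ContDiffOn ℝ (0 + n : ℕ) (G.pdx u) G.D := hs.contDiffOn_pdx (by omega)
  have hα' : ContDiffOn ℝ (0 + n : ℕ) (fun p : ℝ × ℝ => c.α p.2) G.D :=
    hc.contDiffOn_α_snd (by omega)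
  have hu : ContDiffOn ℝ (0 + n : ℕ) u G.D := hs.contDiffOn (by omega)
  rw [InterfaceDomain.leftDeriv_eq_cornerDeriv (w := fun p => -1 * G.pdx u p + 1 * (c.α p.2 * u p))
      n (by simpa only [zero_add] using
        (contDiffOn_const.mul hpdx).add (contDiffOn_const.mul (hα'.mul hu)))
      hs.g₁_smooth.continuousOn (fun p hp => by rw [← hs.robin_left p hp]; ring),
    InterfaceDomain.cornerDeriv_linearCombination _ _ hpdx (hα'.mul hu),
    InterfaceDomain.cornerDeriv_pdx 0 n (hs.contDiffOn (by omega)),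
    InterfaceDomain.cornerDeriv_mul 0 n hα' hu, jetMul_zero_left_index,
    jetMul₁_congr hα fun _ _ => rfl, neg_one_mul, one_mul]
  rfl

theorem topDeriv_eq_topData (hc : c.IsRegular G M) (hs : IsSolution G c M u f g₁ g₄) {m : ℕ}
    (h : m ≤ M) : G.topDeriv g₄ m = (c.jet G M).topData (G.cornerDeriv u) m := by
  have hβ : ∀ i ≤ m, G.cornerDeriv (fun p => c.β p.1) i 0 = (c.jet G M).β i := fun i hi => by
    rw [← InterfaceDomain.topDeriv_eq_cornerDeriv i (hc.contDiffOn_β_fst (hi.trans h))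
      hc.β_smooth.continuousOn fun _ _ => rfl]
    exact (if_pos (hi.trans h)).symm
  have hpdy : ContDiffOn ℝ (m + 0 : ℕ) (G.pdy u) G.D := hs.contDiffOn_pdy (by omega)
  have hβ' : ContDiffOn ℝ (m + 0 : ℕ) (fun p : ℝ × ℝ => c.β p.1) G.D :=
    hc.contDiffOn_β_fst (by omega)
  have hu : ContDiffOn ℝ (m + 0 : ℕ) u G.D := hs.contDiffOn (by omega)
  rw [InterfaceDomain.topDeriv_eq_cornerDeriv (w := fun p => 1 * G.pdy u p + 1 * (c.β p.1 * u p))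
      m ((contDiffOn_const.mul hpdy).add (contDiffOn_const.mul (hβ'.mul hu)))
      hs.g₄_smooth.continuousOn (fun p hp => by rw [← hs.robin_top p hp]; ring),
    InterfaceDomain.cornerDeriv_linearCombination _ _ hpdy (hβ'.mul hu),
    InterfaceDomain.cornerDeriv_pdy, InterfaceDomain.cornerDeriv_mul m 0 hβ' hu,
    jetMul_zero_right_index, jetMul₁_congr hβ fun _ _ => rfl, one_mul, one_mul]
  rfl

theorem dataCombination_eq (hc : c.IsRegular G M) (hs : IsSolution G c M u f g₁ g₄) :
    dataCombination M (G.cornerDeriv f) (G.leftDeriv g₁) (G.topDeriv g₄)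
      = dataCombination M ((c.jet G M).source (G.cornerDeriv u))
        ((c.jet G M).leftData (G.cornerDeriv u)) ((c.jet G M).topData (G.cornerDeriv u)) :=
  dataCombination_congr (fun _ _ => hs.cornerDeriv_eq_source hc)
    (fun _ => hs.leftDeriv_eq_leftData hc) fun _ => hs.topDeriv_eq_topData hc

end IsSolution

end CornerData

section SixthOrder

theorem InterfaceDomain.isBigO_eval_gridSize (G : InterfaceDomain) (P : Polynomial ℝ) :
    (fun N₁ => P.eval (G.gridSize N₁)) =O[atTop] (fun _ : ℕ => (1 : ℝ)) :=
  ((P.continuous.tendsto 0).comp G.tendsto_gridSize).isBigO_one ℝ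

theorem hasOrder_ofPolynomial {G : InterfaceDomain} {c : Coeffs} (hc : c.IsRegular G 5)
    {C : Fin 2 → Fin 2 → Polynomial ℝ} {e : ℕ → (ℕ → ℕ → ℝ) × (ℕ → ℝ) × (ℕ → ℝ)}
    (hC : ∀ u : ℕ → ℕ → ℝ, ∀ d < 7, stencilCoeff (fun k j => (C k j).coeff) u d
      = dataCombination 5 ((c.jet G 5).source u) ((c.jet G 5).leftData u) ((c.jet G 5).topData u)
        (e d)) :
    (CornerScheme.ofPolynomial C e).HasOrder G c 5 6 := by
  intro u f g₁ g₄ hs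
  obtain ⟨P, hP⟩ := stencil_eval_sub_eq C (G.cornerDeriv u) 7
  have hTaylor : (fun N₁ => ∑ k, ∑ j, (C k j).eval (G.gridSize N₁) * (u (G.gridPoint N₁ k j) -
      ∑ i ∈ Finset.range 7, G.gridSize N₁ ^ i * stencilTaylor (G.cornerDeriv u) k j i))
      =O[atTop] (fun N₁ : ℕ => G.gridSize N₁ ^ 7) :=
    IsBigO.fun_sum fun k _ => IsBigO.fun_sum fun j _ => by
      simpa only [one_mul] using (G.isBigO_eval_gridSize (C k j)).mul
        (InterfaceDomain.taylor_gridPoint 6 (hs.contDiffOn (M := 5) le_rfl) k j)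
  have hremainder : (fun N₁ => G.gridSize N₁ ^ 7 * P.eval (G.gridSize N₁))
      =O[atTop] (fun N₁ : ℕ => G.gridSize N₁ ^ 7) := by
    simpa only [mul_one] using (isBigO_refl (fun N₁ : ℕ => G.gridSize N₁ ^ 7) atTop).mul
      (G.isBigO_eval_gridSize P)
  refine (hTaylor.add hremainder).congr_left fun N₁ => ?_
  have hrhs : (CornerScheme.ofPolynomial C e).rhs G f g₁ g₄ N₁ = ∑ d ∈ Finset.range 7,
      G.gridSize N₁ ^ d * stencilCoeff (fun k j => (C k j).coeff) (G.cornerDeriv u) d := by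
    rw [CornerScheme.rhs_ofPolynomial, IsSolution.dataCombination_eq (M := 5) hc hs]
    exact Finset.sum_congr rfl fun d hd => by rw [hC _ d (Finset.mem_range.1 hd)]
  rw [hrhs, ← hP]
  simp only [CornerScheme.lhs, CornerScheme.ofPolynomial, mul_sub, Finset.sum_sub_distrib]
  ring

theorem exists_sixth_order_scheme (J : CornerJet) : ∃ S : CornerScheme,
    ∀ (G : InterfaceDomain) (c : Coeffs), c.IsRegular G 5 → c.jet G 5 = J →
      S.M = 5 ∧ S.IsPolynomial 6 ∧ (∀ k j, S.C k j 0 ≠ 0) ∧ S.HasOrder G c 5 6 := by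
  by_cases hJ : J.a 0 0 = 0
  · refine ⟨⟨0, 0, 0, 0, 0⟩, fun G c hc h => absurd hJ ?_⟩
    rw [← h]
    exact (hc.a_pos _ G.corner_mem_D).ne'
  obtain ⟨C, hdeg, hC₀, e, hC⟩ := exists_stencil_eq_dataCombination hJ
  exact ⟨.ofPolynomial C e, fun G c hc h => ⟨rfl, CornerScheme.isPolynomial_ofPolynomial e hdeg,
    hC₀, hasOrder_ofPolynomial hc (h ▸ hC)⟩⟩

end SixthOrder

/-! ### Harmonic test functions -/

section EdgePolynomials

open Polynomial

/-- The polynomial `t ^ (2 i) / (2 i)! + r t ^ (2 i + 1) / (2 i + 1)!`: the normalized even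
monomial, corrected so that it satisfies the Robin condition `P' = r P` at `0`. -/
noncomputable def edgePoly (r : ℝ) (i : ℕ) : ℝ[X] :=
  monomial (2 * i) (1 / (2 * i).factorial : ℝ) + monomial (2 * i + 1) (r / (2 * i + 1).factorial)

variable (r : ℝ) (i : ℕ)

theorem eval_edgePoly (t : ℝ) : (edgePoly r i).eval t
    = t ^ (2 * i) / (2 * i).factorial * (1 + r * t / (2 * i + 1 : ℕ)) := by
  have hfact : ((2 * i).factorial : ℝ) ≠ 0 := by positivity
  simp only [edgePoly, eval_add, eval_monomial, Nat.factorial_succ]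
  push_cast
  field_simp
  ring

theorem derivative_edgePoly_eval_zero :
    (edgePoly r i).derivative.eval 0 = r * (edgePoly r i).eval 0 := by
  rcases i with _ | i <;> simp [edgePoly, mul_add]

theorem derivative_derivative_edgePoly_zero : (edgePoly r 0).derivative.derivative = 0 := by
  simp [edgePoly]

theorem derivative_derivative_edgePoly_succ :
    (edgePoly r (i + 1)).derivative.derivative = edgePoly r i := by
  have hmonomial : ∀ (n : ℕ) (s : ℝ),
      (monomial (n + 2) (s / (n + 2).factorial)).derivative.derivative
        = monomial n (s / n.factorial) := fun n s => by
    have hfact : (n.factorial : ℝ) ≠ 0 := by positivity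
    simp only [derivative_monomial, Nat.add_sub_cancel, Nat.factorial_succ,
      show n + 2 - 1 = n + 1 from rfl]
    congr 1
    push_cast
    field_simp
    ring
  simp only [edgePoly, derivative_add]
  exact congrArg₂ (· + ·) (hmonomial (2 * i) 1) (hmonomial (2 * i + 1) r)

end EdgePolynomials

section SeparatedSums

open Polynomial

/-- The polynomial function `∑ A_q(x - x₀) B_q(y - y₀)`, where `z = (x₀, y₀)`. -/
noncomputable def sepSum {ι : Type*} (s : Finset ι) (A B : ι → ℝ[X]) (z : ℝ × ℝ) : ℝ × ℝ → ℝ :=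
  fun p => ∑ q ∈ s, (A q).eval (p.1 - z.1) * (B q).eval (p.2 - z.2)

variable {ι : Type*} (s : Finset ι) (A B : ι → ℝ[X]) (z : ℝ × ℝ)

theorem hasFDerivAt_sepSum (p : ℝ × ℝ) : HasFDerivAt (sepSum s A B z)
    (sepSum s (fun q => (A q).derivative) B z p • ContinuousLinearMap.fst ℝ ℝ ℝ
      + sepSum s A (fun q => (B q).derivative) z p • ContinuousLinearMap.snd ℝ ℝ ℝ) p := by
  have hA : ∀ q, HasFDerivAt (fun p : ℝ × ℝ => (A q).eval (p.1 - z.1))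
      ((A q).derivative.eval (p.1 - z.1) • ContinuousLinearMap.fst ℝ ℝ ℝ) p := fun q =>
    ((A q).hasDerivAt _).comp_hasFDerivAt (f := fun p : ℝ × ℝ => p.1 - z.1) p
      (hasFDerivAt_fst.sub_const z.1)
  have hB : ∀ q, HasFDerivAt (fun p : ℝ × ℝ => (B q).eval (p.2 - z.2))
      ((B q).derivative.eval (p.2 - z.2) • ContinuousLinearMap.snd ℝ ℝ ℝ) p := fun q =>
    ((B q).hasDerivAt _).comp_hasFDerivAt (f := fun p : ℝ × ℝ => p.2 - z.2) p
      (hasFDerivAt_snd.sub_const z.2)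
  refine (HasFDerivAt.fun_sum fun q _ => (hA q).mul (hB q)).congr_fderiv ?_
  simp only [sepSum, Finset.sum_smul, Finset.sum_add_distrib, smul_smul, mul_comm]
  exact add_comm _ _

theorem contDiff_sepSum {n : WithTop ℕ∞} : ContDiff ℝ n (sepSum s A B z) := by
  have heval : ∀ P : ℝ[X], ContDiff ℝ n fun x => P.eval x := fun P => by
    simpa only [coe_aeval_eq_eval] using P.contDiff_aeval (𝕜 := ℝ) n
  exact ContDiff.sum fun q _ => ((heval (A q)).comp (contDiff_fst.sub contDiff_const)).mul
    ((heval (B q)).comp (contDiff_snd.sub contDiff_const))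

variable {G : InterfaceDomain}

theorem pdx_sepSum :
    EqOn (G.pdx (sepSum s A B z)) (sepSum s (fun q => (A q).derivative) B z) G.D := fun p hp =>
  (dirDerivWithin_eq_of_hasFDerivAt G.uniqueDiffOn_D hp (hasFDerivAt_sepSum s A B z p)).trans
    (by simp)

theorem pdy_sepSum :
    EqOn (G.pdy (sepSum s A B z)) (sepSum s A (fun q => (B q).derivative) z) G.D := fun p hp =>
  (dirDerivWithin_eq_of_hasFDerivAt G.uniqueDiffOn_D hp (hasFDerivAt_sepSum s A B z p)).trans
    (by simp)

end SeparatedSums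

section RobinHarmonic

open Polynomial

/-- The harmonic polynomial with leading part `Re (x + i y) ^ (2 n) / (2 n)!` at the corner which
satisfies the homogeneous Robin conditions with the constants `α₀` and `β₀`. -/
noncomputable def robinHarmonic (G : InterfaceDomain) (α₀ β₀ : ℝ) (n : ℕ) : ℝ × ℝ → ℝ :=
  sepSum (Finset.HasAntidiagonal.antidiagonal n)
    (fun q => C ((-1) ^ q.2) * edgePoly α₀ q.1) (fun q => edgePoly (-β₀) q.2) G.corner

variable {G : InterfaceDomain} (α₀ β₀ : ℝ) (n : ℕ)

theorem contDiffOn_robinHarmonic {m : WithTop ℕ∞} :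
    ContDiffOn ℝ m (robinHarmonic G α₀ β₀ n) G.D :=
  (contDiff_sepSum _ _ _ _).contDiffOn

theorem laplacian_robinHarmonic : EqOn
    (fun p => G.pdx (G.pdx (robinHarmonic G α₀ β₀ n)) p + G.pdy (G.pdy (robinHarmonic G α₀ β₀ n)) p)
    0 G.D := by
  intro p hp
  have hxx : G.pdx (G.pdx (robinHarmonic G α₀ β₀ n)) p = sepSum _ _ _ _ p :=
    (eqOn_dirDerivWithin (pdx_sepSum _ _ _ _)).trans (pdx_sepSum _ _ _ _) hp
  have hyy : G.pdy (G.pdy (robinHarmonic G α₀ β₀ n)) p = sepSum _ _ _ _ p :=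
    (eqOn_dirDerivWithin (pdy_sepSum _ _ _ _)).trans (pdy_sepSum _ _ _ _) hp
  refine (congrArg₂ (· + ·) hxx hyy).trans ?_
  rcases n with _ | n
  · simp [sepSum, derivative_derivative_edgePoly_zero]
  · simp only [sepSum]
    rw [Finset.Nat.sum_antidiagonal_succ, Finset.Nat.sum_antidiagonal_succ']
    simp only [derivative_C_mul, derivative_derivative_edgePoly_zero,
      derivative_derivative_edgePoly_succ, mul_zero, eval_zero, zero_mul, zero_add, eval_mul,
      eval_C, Pi.zero_apply, ← Finset.sum_add_distrib]
    exact Finset.sum_eq_zero fun q _ => by ring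

theorem robin_left_robinHarmonic {p : ℝ × ℝ} (hp : p ∈ G.Γ₁ ∩ G.D) :
    -G.pdx (robinHarmonic G α₀ β₀ n) p + α₀ * robinHarmonic G α₀ β₀ n p = 0 := by
  have hp₁ : p.1 = G.l₁ := hp.1.1
  rw [robinHarmonic, pdx_sepSum _ _ _ _ hp.2]
  simp only [sepSum, hp₁, InterfaceDomain.corner, sub_self, derivative_C_mul, eval_mul, eval_C,
    derivative_edgePoly_eval_zero, Finset.mul_sum, ← Finset.sum_neg_distrib,
    ← Finset.sum_add_distrib]
  exact Finset.sum_eq_zero fun q _ => by ring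

theorem robin_top_robinHarmonic {p : ℝ × ℝ} (hp : p ∈ G.Γ₄ ∩ G.D) :
    G.pdy (robinHarmonic G α₀ β₀ n) p + β₀ * robinHarmonic G α₀ β₀ n p = 0 := by
  have hp₂ : p.2 = G.l₄ := hp.1.2
  rw [robinHarmonic, pdy_sepSum _ _ _ _ hp.2]
  simp only [sepSum, hp₂, InterfaceDomain.corner, sub_self, eval_mul, eval_C,
    derivative_edgePoly_eval_zero, Finset.mul_sum, ← Finset.sum_add_distrib]
  exact Finset.sum_eq_zero fun q _ => by ring

theorem lhs_robinHarmonic (S : CornerScheme) {N₁ : ℕ} (hN : 0 < N₁) :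
    S.lhs G (robinHarmonic G α₀ β₀ n) N₁ = ∑ k : Fin 2, ∑ j : Fin 2, S.C k j (G.gridSize N₁) *
      ∑ q ∈ Finset.HasAntidiagonal.antidiagonal n, (-1) ^ q.2 *
        (edgePoly α₀ q.1).eval (G.gridSize N₁ * ((k : ℕ) : ℝ)) *
        (edgePoly (-β₀) q.2).eval (-(G.gridSize N₁ * ((j : ℕ) : ℝ))) := by
  simp [CornerScheme.lhs, InterfaceDomain.gridPoint_eq hN, robinHarmonic, sepSum]

end RobinHarmonic

section Source

variable {G : InterfaceDomain} {c : Coeffs} {u : ℝ × ℝ → ℝ}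

/-- The function `-∇·(a∇u)` on `G.D`, the source term for which `u` solves the equation. -/
noncomputable def Coeffs.ellipticOp (c : Coeffs) (G : InterfaceDomain) (u : ℝ × ℝ → ℝ) :
    ℝ × ℝ → ℝ :=
  fun p => -(G.pdx (fun q => c.a q * G.pdx u q) p + G.pdy (fun q => c.a q * G.pdy u q) p)

theorem Coeffs.IsRegular.contDiffOn_ellipticOp (hc : c.IsRegular G ⊤) (hu : ContDiffOn ℝ ∞ u G.D) :
    ContDiffOn ℝ ∞ (c.ellipticOp G u) G.D := by
  have ha : ContDiffOn ℝ ∞ c.a G.D := hc.a_smooth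
  exact ((InterfaceDomain.contDiffOn_pdx
      (ha.mul (InterfaceDomain.contDiffOn_pdx hu le_rfl)) le_rfl).add
    (InterfaceDomain.contDiffOn_pdy
      (ha.mul (InterfaceDomain.contDiffOn_pdy hu le_rfl)) le_rfl)).neg

theorem ellipticOp_eventuallyEq_zero {a₀ : ℝ} (ha : ∀ᶠ q in 𝓝[G.D] G.corner, c.a q = a₀)
    (hu : ContDiffOn ℝ 2 u G.D)
    (hharm : EqOn (fun p => G.pdx (G.pdx u) p + G.pdy (G.pdy u) p) 0 G.D) :
    c.ellipticOp G u =ᶠ[𝓝[G.D] G.corner] fun _ => 0 := by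
  have hflux : ∀ v : ℝ × ℝ, dirDerivWithin G.D v (fun q => c.a q * dirDerivWithin G.D v u q)
      =ᶠ[𝓝[G.D] G.corner] fun p => a₀ * dirDerivWithin G.D v (dirDerivWithin G.D v u) p := by
    intro v
    have hconst : (fun q => c.a q * dirDerivWithin G.D v u q) =ᶠ[𝓝[G.D] G.corner]
        fun q => ∑ _i : Unit, a₀ • dirDerivWithin G.D v u q := by
      filter_upwards [ha] with q hq
      simp [hq]
    have hsum := dirDerivWithin_sum (v := v) G.uniqueDiffOn_D (Finset.univ : Finset Unit)
      (fun _ => a₀) (fun _ => dirDerivWithin G.D v u) fun _ _ =>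
        contDiffOn_dirDerivWithin G.uniqueDiffOn_D hu (by norm_num)
    filter_upwards [eventuallyEq_iterate_dirDerivWithin (v := v) 1 hconst, self_mem_nhdsWithin]
      with p hp hpD
    exact (hp.trans (hsum hpD)).trans (by simp)
  filter_upwards [hflux (1, 0), hflux (0, 1), self_mem_nhdsWithin] with p hx hy hp
  refine neg_eq_zero.2 ((congrArg₂ (· + ·) hx hy).trans ?_)
  rw [← mul_add]
  exact mul_eq_zero_of_right _ (hharm hp)

theorem CornerScheme.rhs_eq_zero (S : CornerScheme) {f : ℝ × ℝ → ℝ}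
    (hf : f =ᶠ[𝓝[G.D] G.corner] fun _ => 0) (N₁ : ℕ) : S.rhs G f 0 0 N₁ = 0 := by
  have hcorner : ∀ m n, G.cornerDeriv f m n = 0 := fun m n => by
    have hzero : G.pdx^[m] (G.pdy^[n] f) =ᶠ[𝓝[G.D] G.corner] G.pdx^[m] (G.pdy^[n] fun _ => 0) :=
      eventuallyEq_iterate_dirDerivWithin m (eventuallyEq_iterate_dirDerivWithin n hf)
    rw [InterfaceDomain.cornerDeriv, hzero.eq_of_nhdsWithin G.corner_mem_D]
    exact congrFun ((congrArg _ (iterate_dirDerivWithin_zero n)).trans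
      (iterate_dirDerivWithin_zero m)) _
  have hleft : ∀ n, G.leftDeriv 0 n = 0 := fun n => by
    simp [InterfaceDomain.leftDeriv]
  have htop : ∀ n, G.topDeriv 0 n = 0 := fun n => by
    simp [InterfaceDomain.topDeriv]
  simp only [rhs, hcorner, hleft, htop, zero_mul, Finset.sum_const_zero, add_zero]

variable {a₀ α₀ β₀ : ℝ}

theorem isSolution_robinHarmonic (hc : c.IsRegular G ⊤) (hα : c.α = fun _ => α₀)
    (hβ : c.β = fun _ => β₀) (n : ℕ) : IsSolution G c ⊤ (robinHarmonic G α₀ β₀ n)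
      (c.ellipticOp G (robinHarmonic G α₀ β₀ n)) 0 0 where
  u_smooth := contDiffOn_robinHarmonic _ _ _
  f_smooth := hc.contDiffOn_ellipticOp (contDiffOn_robinHarmonic _ _ _)
  g₁_smooth := contDiffOn_const
  g₄_smooth := contDiffOn_const
  pde _ _ := rfl
  robin_left _ hp := hα ▸ robin_left_robinHarmonic _ _ _ hp
  robin_top _ hp := hβ ▸ robin_top_robinHarmonic _ _ _ hp

theorem lhs_robinHarmonic_isBigO (hc : c.IsRegular G ⊤)
    (ha : ∀ᶠ q in 𝓝[G.D] G.corner, c.a q = a₀) (hα : c.α = fun _ => α₀) (hβ : c.β = fun _ => β₀)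
    {S : CornerScheme} {p : ℕ} (hS : S.HasOrder G c ⊤ p) (n : ℕ) :
    (fun N₁ => S.lhs G (robinHarmonic G α₀ β₀ n) N₁)
      =O[atTop] fun N₁ : ℕ => G.gridSize N₁ ^ (p + 1) := by
  refine (hS _ _ _ _ (isSolution_robinHarmonic hc hα hβ n)).congr_left fun N₁ => ?_
  rw [S.rhs_eq_zero (ellipticOp_eventuallyEq_zero ha (contDiffOn_robinHarmonic _ _ _)
    (laplacian_robinHarmonic _ _ _)), sub_zero]

end Source

/-! ### The order barrier -/

theorem tendsto_zero_of_tendsto_mulVec {ι n 𝕜 : Type*} [Fintype n] [DecidableEq n] [NormedField 𝕜]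
    {l : Filter ι} {A : ι → Matrix n n 𝕜} {A₀ : Matrix n n 𝕜} {v : ι → n → 𝕜}
    (hA : Tendsto A l (𝓝 A₀)) (hdet : A₀.det ≠ 0)
    (hv : Tendsto (fun i => (A i).mulVec (v i)) l (𝓝 0)) : Tendsto v l (𝓝 0) := by
  have hdet_tendsto : Tendsto (fun i => (A i).det) l (𝓝 A₀.det) :=
    (continuous_id.matrix_det.tendsto A₀).comp hA
  have hadjugate : Tendsto (fun i => (A i).adjugate.mulVec ((A i).mulVec (v i))) l (𝓝 0) := by
    have hmulVec : Continuous fun p : Matrix n n 𝕜 × (n → 𝕜) => p.1.adjugate.mulVec p.2 :=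
      continuous_fst.matrix_adjugate.matrix_mulVec continuous_snd
    simpa only [Function.comp_def, Matrix.mulVec_zero] using
      (hmulVec.tendsto (A₀, 0)).comp (hA.prodMk_nhds hv)
  have hcramer : (fun i => (A i).det⁻¹ • (A i).adjugate.mulVec ((A i).mulVec (v i))) =ᶠ[l] v := by
    filter_upwards [hdet_tendsto.eventually_ne hdet] with i hi
    rw [Matrix.mulVec_mulVec, Matrix.adjugate_mul, Matrix.smul_mulVec, Matrix.one_mulVec,
      inv_smul_smul₀ hi]
  simpa only [smul_zero] using ((hdet_tendsto.inv₀ hdet).smul hadjugate).congr' hcramer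

section OrderBarrier

/-- The matrix which sends the stencil coefficients `(C₀₀, C₁₀, C₀₁, C₁₁)` on a grid of size `h` to
the normalized values of the stencil on the harmonic polynomials `robinHarmonic G α₀ β₀ n`, `n ≤ 3`.
As `h → 0` the rows for `n = 1` and `n = 3` agree to leading order; the last row is the difference
of these two rows divided by `h`. -/
noncomputable def testMatrix (α₀ β₀ h : ℝ) : Matrix (Fin 4) (Fin 4) ℝ :=
  !![1, 1 + α₀ * h, 1 + β₀ * h, (1 + α₀ * h) * (1 + β₀ * h);
    0, 1 + α₀ * h / 3, -(1 + β₀ * h / 3), 2 / 3 * (β₀ - α₀) * h;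
    0, 1 + α₀ * h / 5, 1 + β₀ * h / 5, (1 + α₀ * h / 5) * (1 + β₀ * h)
      - 6 * (1 + α₀ * h / 3) * (1 + β₀ * h / 3) + (1 + α₀ * h) * (1 + β₀ * h / 5);
    0, -4 / 21 * α₀, 4 / 21 * β₀, 38 / 21 * (α₀ - β₀)]

variable (α₀ β₀ : ℝ)

theorem continuous_testMatrix : Continuous (testMatrix α₀ β₀) := by
  unfold testMatrix
  fun_prop

theorem det_testMatrix_zero : (testMatrix α₀ β₀ 0).det = 20 / 7 * (α₀ - β₀) := by
  simp [testMatrix, Matrix.det_succ_row_zero, Fin.sum_univ_succ, Fin.succAbove]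
  ring

variable {α₀ β₀} {G : InterfaceDomain}

theorem testMatrix_mulVec (S : CornerScheme) {N₁ : ℕ} (hN : 0 < N₁) :
    (testMatrix α₀ β₀ (G.gridSize N₁)).mulVec ![S.C 0 0 (G.gridSize N₁), S.C 1 0 (G.gridSize N₁),
        S.C 0 1 (G.gridSize N₁), S.C 1 1 (G.gridSize N₁)]
      = ![S.lhs G (robinHarmonic G α₀ β₀ 0) N₁,
          2 * (S.lhs G (robinHarmonic G α₀ β₀ 1) N₁ / G.gridSize N₁ ^ 2),
          24 * (S.lhs G (robinHarmonic G α₀ β₀ 2) N₁ / G.gridSize N₁ ^ 4),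
          720 * (S.lhs G (robinHarmonic G α₀ β₀ 3) N₁ / G.gridSize N₁ ^ 7)
            - 2 * (S.lhs G (robinHarmonic G α₀ β₀ 1) N₁ / G.gridSize N₁ ^ 3)] := by
  have hh := (G.gridSize_pos hN).ne'
  simp only [lhs_robinHarmonic _ _ _ S hN]
  generalize G.gridSize N₁ = h at hh
  ext i
  fin_cases i <;>
    simp [testMatrix, Matrix.mulVec, dotProduct, Fin.sum_univ_succ, Finset.Nat.antidiagonal_succ,
      eval_edgePoly, Nat.factorial] <;> field_simp <;> ring

theorem InterfaceDomain.tendsto_div_gridSize_pow {f : ℕ → ℝ} {m p : ℕ}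
    (hf : f =O[atTop] fun N₁ => G.gridSize N₁ ^ p) (hmp : m < p) :
    Tendsto (fun N₁ => f N₁ / G.gridSize N₁ ^ m) atTop (𝓝 0) :=
  (hf.trans_isLittleO ((isLittleO_pow_pow hmp).comp_tendsto
    G.tendsto_gridSize)).tendsto_div_nhds_zero

theorem CornerScheme.tendsto_zero_of_lhs_isBigO (hαβ : α₀ ≠ β₀) {S : CornerScheme} {p : ℕ}
    (hp : 7 < p) (hS : ∀ n, (fun N₁ => S.lhs G (robinHarmonic G α₀ β₀ n) N₁)
      =O[atTop] fun N₁ : ℕ => G.gridSize N₁ ^ p) (k j : Fin 2) :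
    Tendsto (fun N₁ => S.C k j (G.gridSize N₁)) atTop (𝓝 0) := by
  have hvalue : ∀ n, ∀ m ≤ 7,
      Tendsto (fun N₁ => S.lhs G (robinHarmonic G α₀ β₀ n) N₁ / G.gridSize N₁ ^ m) atTop (𝓝 0) :=
    fun n m hm => G.tendsto_div_gridSize_pow (hS n) (hm.trans_lt hp)
  have hmulVec : Tendsto (fun N₁ => (testMatrix α₀ β₀ (G.gridSize N₁)).mulVec
      ![S.C 0 0 (G.gridSize N₁), S.C 1 0 (G.gridSize N₁), S.C 0 1 (G.gridSize N₁),
        S.C 1 1 (G.gridSize N₁)]) atTop (𝓝 0) := by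
    refine Tendsto.congr' ((eventually_gt_atTop 0).mono fun N₁ hN =>
      (testMatrix_mulVec S hN).symm) (tendsto_pi_nhds.2 fun i => ?_)
    fin_cases i
    · simpa using hvalue 0 0
    · simpa using (hvalue 1 2 (by norm_num)).const_mul 2
    · simpa using (hvalue 2 4 (by norm_num)).const_mul 24
    · simpa using ((hvalue 3 7 (by norm_num)).const_mul 720).sub
        ((hvalue 1 3 (by norm_num)).const_mul 2)
  have hC := tendsto_pi_nhds.1 <| tendsto_zero_of_tendsto_mulVec
    (((continuous_testMatrix α₀ β₀).tendsto 0).comp G.tendsto_gridSize)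
    (by simpa [det_testMatrix_zero, sub_eq_zero] using hαβ) hmulVec
  fin_cases k <;> fin_cases j
  exacts [hC 0, hC 2, hC 1, hC 3]

theorem order_le_six {c : Coeffs} {a₀ : ℝ} (hc : c.IsRegular G ⊤)
    (ha : ∀ᶠ q in 𝓝[G.D] G.corner, c.a q = a₀) (hα : c.α = fun _ => α₀) (hβ : c.β = fun _ => β₀)
    (hαβ : α₀ ≠ β₀) {S : CornerScheme} (hS : S.Nontrivial G) {p : ℕ} (hp : S.HasOrder G c ⊤ p) :
    p ≤ 6 := by
  by_contra! hp6
  exact hS (S.tendsto_zero_of_lhs_isBigO hαβ (Nat.succ_lt_succ hp6)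
    (lhs_robinHarmonic_isBigO hc ha hα hβ hp))

end OrderBarrier

section Mono

variable {G : InterfaceDomain} {c : Coeffs} {r s : ℕ∞}

theorem Coeffs.IsRegular.mono (hc : c.IsRegular G s) (hrs : r ≤ s) : c.IsRegular G r where
  a_pos := hc.a_pos
  a_smooth := hc.a_smooth.of_le (mod_cast add_le_add_left hrs 1)
  α_smooth := hc.α_smooth.of_le (mod_cast hrs)
  β_smooth := hc.β_smooth.of_le (mod_cast hrs)

theorem IsSolution.mono {u f : ℝ × ℝ → ℝ} {g₁ g₄ : ℝ → ℝ} (hs : IsSolution G c s u f g₁ g₄)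
    (hrs : r ≤ s) : IsSolution G c r u f g₁ g₄ where
  u_smooth := hs.u_smooth.of_le (mod_cast add_le_add_left hrs 2)
  f_smooth := hs.f_smooth.of_le (mod_cast hrs)
  g₁_smooth := hs.g₁_smooth.of_le (mod_cast hrs)
  g₄_smooth := hs.g₄_smooth.of_le (mod_cast hrs)
  pde := hs.pde
  robin_left := hs.robin_left
  robin_top := hs.robin_top

theorem CornerScheme.HasOrder.mono {S : CornerScheme} {p : ℕ} (hS : S.HasOrder G c r p)
    (hrs : r ≤ s) : S.HasOrder G c s p := fun u f g₁ g₄ hu => hS u f g₁ g₄ (hu.mono hrs)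

theorem CornerScheme.IsPolynomial.nontrivial {S : CornerScheme} {d : ℕ} (hS : S.IsPolynomial d)
    {k j : Fin 2} (hkj : S.C k j 0 ≠ 0) (G : InterfaceDomain) : S.Nontrivial G := fun hzero => by
  obtain ⟨P, -, hP⟩ := hS.C_poly k j
  have hlimit : Tendsto (fun N₁ => S.C k j (G.gridSize N₁)) atTop (𝓝 (S.C k j 0)) := by
    simpa only [hP, Function.comp_def] using (P.continuous.tendsto 0).comp G.tendsto_gridSize
  exact hkj (tendsto_nhds_unique hlimit (hzero k j))

end Mono

end CornerFD

theorem theorem2p6 :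
    -- a sixth-order 4-point scheme, built from the jet of the coefficients at the corner
    (∃ S : CornerFD.CornerJet → CornerFD.CornerScheme,
      ∀ (G : CornerFD.InterfaceDomain) (c : CornerFD.Coeffs), c.IsRegular G 5 →
        (S (c.jet G 5)).M = 5 ∧
        (S (c.jet G 5)).IsPolynomial 6 ∧
        (∀ k j, (S (c.jet G 5)).C k j 0 ≠ 0) ∧
        (S (c.jet G 5)).HasOrder G c 5 6) ∧
    -- six is the maximum order for smooth `a`, `α`, `β` with distinct corner values of `α`, `β`
    (∀ (G : CornerFD.InterfaceDomain) (α₀ β₀ : ℝ), α₀ ≠ β₀ →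
      IsGreatest {p : ℕ | ∀ c : CornerFD.Coeffs, c.IsRegular G ⊤ →
        c.α G.l₄ = α₀ → c.β G.l₁ = β₀ →
        ∃ S : CornerFD.CornerScheme, S.Nontrivial G ∧ S.HasOrder G c ⊤ p} 6) ∧
    -- no scheme exceeds it when `α ≠ β` are constant and `a` is constant near the corner
    (∀ (G : CornerFD.InterfaceDomain) (c : CornerFD.Coeffs) (a₀ α₀ β₀ : ℝ), c.IsRegular G ⊤ →
      (∀ᶠ q in 𝓝[G.D] G.corner, c.a q = a₀) →
      c.α = (fun _ => α₀) → c.β = (fun _ => β₀) → α₀ ≠ β₀ →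
      ∀ S : CornerFD.CornerScheme, S.Nontrivial G →
        ∀ p : ℕ, S.HasOrder G c ⊤ p → p ≤ 6) := by
  choose S hS using CornerFD.exists_sixth_order_scheme
  refine ⟨⟨S, fun G c hc => hS _ G c hc rfl⟩, fun G α₀ β₀ hαβ => ⟨fun c hc _ _ => ?_,
    fun p hp => ?_⟩, fun G c a₀ α₀ β₀ hc ha hα hβ hαβ T hT p hp =>
      CornerFD.order_le_six hc ha hα hβ hαβ hT hp⟩
  · obtain ⟨-, hpoly, hne, horder⟩ := hS _ G c (hc.mono le_top) rfl
    exact ⟨S (c.jet G 5), hpoly.nontrivial (hne 0 0) G, horder.mono le_top⟩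
  · have hc : CornerFD.Coeffs.IsRegular ⟨fun _ => 1, fun _ => α₀, fun _ => β₀⟩ G ⊤ :=
      ⟨fun _ _ => one_pos, contDiffOn_const, contDiffOn_const, contDiffOn_const⟩
    obtain ⟨T, hT, horder⟩ := hp _ hc rfl rfl
    exact CornerFD.order_le_six hc (Eventually.of_forall fun _ => rfl) rfl rfl hαβ hT horder
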